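/- Let $T>0$. Consider on the unit interval the semilinear hyperbolic system $$\partial_t p+\partial_x u=0,\qquad \partial_t u+\partial_x p+a(u)=0,\qquad x\in(0,1),\ 0<t\le T,$$ with boundary conditions $u(0,t)=g_0(t)$, $u(1,t)=g_1(t)$ for $0<t\le T$ and initial conditions $p(x,0)=p_0(x)$, $u(x,0)=u_0(x)$ for $x\in(0,1)$. Assume: * (A1) $a\in W^{3,\infty}_{loc}(\mathbb R)$ (identified with its continuous representative), $a(0)=0$, and $a_0\le a'\le a_1$, $|a''|\le a_2$, $|a'''|\le a_3$ almost everywhere on $\mathbb R$, with positive constants $a_0,a_1,a_2,a_3$; * (A2) $u_0=0$ and $p_0=c$ for a constant $c\in\mathbb R$; * (A3) $g_0,g_1\in C^4([0,T])$ with $g_0(0)=g_1(0)=0$ and $g_0'(0)=g_1'(0)=0$. Then there is a unique classical solution, that is, a unique pair $$(p,u)\in C^1([0,T];L^2(0,1)\times L^2(0,1))\cap C([0,T];H^1(0,1)\times H^1(0,1))$$ that satisfies the two equations in $L^2(0,1)$ for every $t\in(0,T]$, the boundary conditions in the sense of traces, and the initial conditions. Moreover, if $M$ is a number with $|c|\le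 M$ and $|g_i^{(k)}|\le M$ on $[0,T]$ for $i=0,1$ and $k=0,\dots,4$, then $$\|(p,u)\|_{C([0,T];H^1\times H^1)}+\|(p,u)\|_{C^1([0,T];L^2\times L^2)}\le C',$$ with a constant $C'$ that depends only on $a_0,a_1,a_2,a_3$, $M$ and $T$. Finally, the pressure drop $\triangle p(t):=p(0,t)-p(1,t)$ belongs to $C^\gamma([0,T])$ for every $0\le\gamma<1/2$, and $$\|\triangle p\|_{C^\gamma([0,T])}\le C'(\gamma),$$ with a constant $C'(\gamma)$ that depends only on $\gamma$, $a_0,a_1,a_2,a_3$, $M$ and $T$. -/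

import Mathlib

open MeasureTheory Set Filter
open scoped ENNReal NNReal ContDiff

namespace PipeFlow

/-- `v` is the weak (distributional) derivative of `f` on the open set `Ω ⊆ ℝ`. -/
structure HasWeakDeriv (Ω : Set ℝ) (f v : ℝ → ℝ) : Prop where
  locInt : LocallyIntegrableOn f Ω
  locInt_deriv : LocallyIntegrableOn v Ω
  integral_eq : ∀ φ : ℝ → ℝ, ContDiff ℝ ∞ φ → HasCompactSupport φ → tsupport φ ⊆ Ω →
    ∫ x in Ω, f x * deriv φ x = - ∫ x in Ω, v x * φ x

/-- The space `L²(0,1)`. -/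
abbrev L2 : Type := Lp ℝ 2 (volume.restrict (Ioo (0 : ℝ) 1))

theorem L2.integrableOn (f : L2) : IntegrableOn f (Ioo (0 : ℝ) 1) :=
  (Lp.memLp f).integrable (by norm_num)

theorem integrableOn_mul_test {f φ : ℝ → ℝ} (hf : IntegrableOn f (Ioo (0 : ℝ) 1))
    (hφ : Continuous φ) : IntegrableOn (fun x => f x * φ x) (Ioo (0 : ℝ) 1) := by
  rw [← integrableOn_Icc_iff_integrableOn_Ioo] at hf ⊢
  exact hf.mul_continuousOn hφ.continuousOn isCompact_Icc

/-- The pairs `(f, ∂ₓf)` in `L²(0,1) × L²(0,1)` in which the second entry is the weak derivative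
of the first one. -/
def H1Graph : Submodule ℝ (WithLp 2 (L2 × L2)) where
  carrier := {w | HasWeakDeriv (Ioo 0 1) w.fst w.snd}
  zero_mem' := by
    refine ⟨(L2.integrableOn _).locallyIntegrableOn, (L2.integrableOn _).locallyIntegrableOn, ?_⟩
    intro φ _ _ _
    have h0 : ((0 : L2) : ℝ → ℝ) =ᵐ[volume.restrict (Ioo (0 : ℝ) 1)] 0 := Lp.coeFn_zero _ _ _
    have key : ∀ ψ : ℝ → ℝ, ∫ x in Ioo (0 : ℝ) 1, ((0 : L2) : ℝ → ℝ) x * ψ x = 0 := fun ψ => by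
      rw [integral_congr_ae (g := fun _ => (0 : ℝ)) (h0.mono fun x hx => by
        beta_reduce
        rw [hx, Pi.zero_apply, zero_mul])]
      simp
    simp only [WithLp.zero_fst, WithLp.zero_snd, key, neg_zero]
  add_mem' := by
    rintro w z hw hz
    refine ⟨(L2.integrableOn _).locallyIntegrableOn, (L2.integrableOn _).locallyIntegrableOn, ?_⟩
    intro φ h1 h2 h3
    have key : ∀ (f g : L2) (ψ : ℝ → ℝ), Continuous ψ →
        ∫ x in Ioo (0 : ℝ) 1, ((f + g : L2) : ℝ → ℝ) x * ψ x
          = (∫ x in Ioo (0 : ℝ) 1, f x * ψ x) + ∫ x in Ioo (0 : ℝ) 1, g x * ψ x :=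
      fun f g ψ hψ => by
        rw [← integral_add (integrableOn_mul_test (L2.integrableOn f) hψ)
          (integrableOn_mul_test (L2.integrableOn g) hψ)]
        exact integral_congr_ae ((Lp.coeFn_add f g).mono fun x hx => by
          beta_reduce
          rw [hx, Pi.add_apply, add_mul])
    have hd : Continuous (deriv φ) := h1.continuous_deriv (by simp)
    rw [WithLp.add_fst, WithLp.add_snd, key _ _ _ hd, key _ _ _ h1.continuous,
      hw.integral_eq φ h1 h2 h3, hz.integral_eq φ h1 h2 h3]
    ring
  smul_mem' := by
    rintro c w hw
    refine ⟨(L2.integrableOn _).locallyIntegrableOn, (L2.integrableOn _).locallyIntegrableOn, ?_⟩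
    intro φ h1 h2 h3
    have key : ∀ (f : L2) (ψ : ℝ → ℝ),
        ∫ x in Ioo (0 : ℝ) 1, ((c • f : L2) : ℝ → ℝ) x * ψ x
          = c * ∫ x in Ioo (0 : ℝ) 1, f x * ψ x := fun f ψ => by
      rw [← integral_const_mul]
      exact integral_congr_ae ((Lp.coeFn_smul c f).mono fun x hx => by
        beta_reduce
        rw [hx, Pi.smul_apply, smul_eq_mul, mul_assoc])
    rw [WithLp.smul_fst, WithLp.smul_snd, key, key, hw.integral_eq φ h1 h2 h3]
    ring

/-- The Sobolev space `H¹(0,1)`, as the space of all pairs `(f, ∂ₓf)`. Its norm is the usual one,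
`(‖f‖² + ‖∂ₓf‖²)^(1/2)`. -/
abbrev H1 : Type := H1Graph

/-- The function `f ∈ L²(0,1)` underlying an element of `H¹(0,1)`. -/
def H1.toL2 (f : H1) : L2 := (f : WithLp 2 (L2 × L2)).fst

/-- The weak derivative `∂ₓf ∈ L²(0,1)` of an element of `H¹(0,1)`. -/
def H1.dx (f : H1) : L2 := (f : WithLp 2 (L2 × L2)).snd

theorem ae_eq_const_of_test {f : ℝ → ℝ} (hf : IntegrableOn f (Ioo (0 : ℝ) 1))
    (h : ∀ φ : ℝ → ℝ, ContDiff ℝ ∞ φ → HasCompactSupport φ → tsupport φ ⊆ Ioo 0 1 →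
      ∫ x in Ioo (0 : ℝ) 1, f x * deriv φ x = 0) :
    ∃ c : ℝ, f =ᵐ[volume.restrict (Ioo (0 : ℝ) 1)] fun _ => c := by
  let B : ContDiffBump (1 / 2 : ℝ) := ⟨1 / 8, 1 / 4, by norm_num, by norm_num⟩
  let ρ : ℝ → ℝ := B.normed volume
  have hρ : ContDiff ℝ ∞ ρ := B.contDiff_normed
  have hρs : HasCompactSupport ρ := B.hasCompactSupport_normed
  have hρt : tsupport ρ ⊆ Ioo 0 1 := by
    intro x hx
    have hx' : x ∈ Metric.closedBall (1 / 2 : ℝ) (1 / 4) := by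
      have := B.tsupport_normed_eq (μ := volume)
      rw [← this]; exact hx
    rw [Metric.mem_closedBall, Real.dist_eq, abs_le] at hx'
    constructor <;> linarith [hx'.1, hx'.2]
  have hρ1 : ∫ x, ρ x = 1 := B.integral_normed
  set c : ℝ := ∫ x in Ioo (0 : ℝ) 1, f x * ρ x with hc
  refine ⟨c, ?_⟩
  have hfc : IntegrableOn (fun x => f x - c) (Ioo (0 : ℝ) 1) :=
    hf.sub (integrableOn_const (by simp) (by simp))
  have main := isOpen_Ioo.ae_eq_zero_of_integral_contDiff_smul_eq_zero (μ := volume)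
    hfc.locallyIntegrableOn (fun ψ hψ hψs hψt => ?_)
  · rw [EventuallyEq, ae_restrict_iff' measurableSet_Ioo]
    filter_upwards [main] with x hx hx'
    linarith [hx hx']
  · set m : ℝ := ∫ x, ψ x with hm
    let χ : ℝ → ℝ := fun x => ψ x - m * ρ x
    have hχ : ContDiff ℝ ∞ χ := hψ.sub (contDiff_const.mul hρ)
    have hψi : Integrable ψ := hψ.continuous.integrable_of_hasCompactSupport hψs
    have hρi : Integrable ρ := hρ.continuous.integrable_of_hasCompactSupport hρs
    have hχi : Integrable χ := hψi.sub (hρi.const_mul m)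
    let K : Set ℝ := tsupport ψ ∪ tsupport ρ
    have hK : IsCompact K := hψs.isCompact.union hρs.isCompact
    have hKt : K ⊆ Ioo 0 1 := union_subset hψt hρt
    have hKne : K.Nonempty := by
      by_contra hne
      rw [not_nonempty_iff_eq_empty] at hne
      have : tsupport ρ = ∅ := subset_empty_iff.1 (hne ▸ subset_union_right)
      have h0 : ρ = 0 := tsupport_eq_empty_iff.1 this
      simp [h0] at hρ1
    have hχK : ∀ x, x ∉ K → χ x = 0 := fun x hx => by
      have h1 : ψ x = 0 := image_eq_zero_of_notMem_tsupport fun h => hx (Or.inl h)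
      have h2 : ρ x = 0 := image_eq_zero_of_notMem_tsupport fun h => hx (Or.inr h)
      simp [χ, h1, h2]
    have hχ0 : ∫ x, χ x = 0 := by
      simp only [χ]
      rw [integral_sub hψi (hρi.const_mul m), integral_const_mul, hρ1]
      ring
    let φ : ℝ → ℝ := fun x => ∫ y in (0 : ℝ)..x, χ y
    have hφd : ∀ x, HasDerivAt φ (χ x) x := fun x =>
      intervalIntegral.integral_hasDerivAt_right (hχi.intervalIntegrable)
        (hχ.continuous.stronglyMeasurableAtFilter _ _) hχ.continuous.continuousAt
    have hφ' : deriv φ = χ := funext fun x => (hφd x).deriv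
    have hφ : ContDiff ℝ ∞ φ := by
      rw [contDiff_infty_iff_deriv]
      exact ⟨fun x => (hφd x).differentiableAt, hφ' ▸ hχ⟩
    have hlo := hKt (hK.sInf_mem hKne)
    have hhi := hKt (hK.sSup_mem hKne)
    have hφs : ∀ x, x ∉ Icc (sInf K) (sSup K) → φ x = 0 := by
      intro x hx
      rw [mem_Icc, not_and_or, not_le, not_le] at hx
      rcases hx with hx | hx
      · apply intervalIntegral.integral_zero_ae
        refine Eventually.of_forall fun y hy => hχK y fun hyK => ?_
        have h1 : sInf K ≤ y := csInf_le hK.bddBelow hyK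
        have h2 : y ≤ max 0 x := by
          rw [uIoc, mem_Ioc] at hy; exact hy.2
        have := max_lt hlo.1 hx
        linarith
      · have hx0 : (0 : ℝ) ≤ x := hhi.1.le.trans hx.le
        have : φ x = ∫ y in Ioc (0 : ℝ) x, χ y := intervalIntegral.integral_of_le hx0
        rw [this, setIntegral_eq_integral_of_forall_compl_eq_zero, hχ0]
        intro y hy
        refine hχK y fun hyK => hy ⟨(hKt hyK).1, (le_csSup hK.bddAbove hyK).trans hx.le⟩
    have hφt : tsupport φ ⊆ Icc (sInf K) (sSup K) :=
      closure_minimal (fun x hx => by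
        by_contra h'
        exact hx (hφs x h')) isClosed_Icc
    have hφc : HasCompactSupport φ := HasCompactSupport.intro isCompact_Icc hφs
    have hz := h φ hφ hφc (hφt.trans fun x hx =>
      ⟨hlo.1.trans_le hx.1, hx.2.trans_lt hhi.2⟩)
    rw [hφ'] at hz
    have e1 : ∫ x in Ioo (0 : ℝ) 1, f x * χ x
        = (∫ x in Ioo (0 : ℝ) 1, f x * ψ x) - m * c := by
      rw [hc, ← integral_const_mul, ← integral_sub (integrableOn_mul_test hf hψ.continuous)
        ((integrableOn_mul_test hf hρ.continuous).const_mul m)]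
      congr 1
      funext x
      simp only [χ]
      ring
    have e2 : ∫ x, ψ x • (f x - c) = ∫ x in Ioo (0 : ℝ) 1, ψ x * (f x - c) := by
      rw [setIntegral_eq_integral_of_forall_compl_eq_zero]
      · simp [smul_eq_mul]
      · intro x hx
        rw [image_eq_zero_of_notMem_tsupport fun h' => hx (hψt h'), zero_mul]
    have e3 : ∫ x in Ioo (0 : ℝ) 1, ψ x = m :=
      setIntegral_eq_integral_of_forall_compl_eq_zero fun x hx =>
        image_eq_zero_of_notMem_tsupport fun h' => hx (hψt h')
    have e4 : ∫ x in Ioo (0 : ℝ) 1, ψ x * (f x - c)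
        = (∫ x in Ioo (0 : ℝ) 1, f x * ψ x) - m * c := by
      rw [← e3, ← integral_mul_const, ← integral_sub (integrableOn_mul_test hf hψ.continuous)
        (hψi.integrableOn.mul_const c)]
      congr 1
      funext x
      ring
    rw [e2, e4, ← e1, hz]

/-- Every element of `H¹(0,1)` has a representative that is continuous on `[0,1]`. -/
theorem H1.exists_continuous_rep (f : H1) :
    ∃ φ : ℝ → ℝ, ContinuousOn φ (Icc 0 1) ∧
      (f.toL2 : ℝ → ℝ) =ᵐ[volume.restrict (Ioo (0 : ℝ) 1)] φ := by
  have hw : HasWeakDeriv (Ioo 0 1) f.toL2 f.dx := f.2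
  have hv : IntervalIntegrable (f.dx : ℝ → ℝ) volume 0 1 := by
    rw [intervalIntegrable_iff_integrableOn_Ioo_of_le zero_le_one]
    exact L2.integrableOn _
  let F : ℝ → ℝ := fun x => ∫ y in (0 : ℝ)..x, f.dx y
  have hF : AbsolutelyContinuousOnInterval F 0 1 :=
    hv.absolutelyContinuousOnInterval_intervalIntegral (by simp)
  have hFc : ContinuousOn F (Icc 0 1) := by
    simpa [uIcc_of_le (zero_le_one (α := ℝ))] using hF.continuousOn
  have hFi : IntegrableOn F (Ioo (0 : ℝ) 1) :=
    (hFc.integrableOn_compact isCompact_Icc).mono_set Ioo_subset_Icc_self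
  obtain ⟨c, hc⟩ := ae_eq_const_of_test (f := fun x => f.toL2 x - F x)
    ((L2.integrableOn _).sub hFi) (fun φ h1 h2 h3 => by
      have hd : Continuous (deriv φ) := h1.continuous_deriv (by simp)
      have hφ0 : φ 0 = 0 := image_eq_zero_of_notMem_tsupport fun h => by simpa using h3 h
      have hφ1 : φ 1 = 0 := image_eq_zero_of_notMem_tsupport fun h => by simpa using h3 h
      have hφA : AbsolutelyContinuousOnInterval φ 0 1 :=
        ((h1.of_le (by simp)).contDiffOn).absolutelyContinuousOnInterval
      have hI := hF.integral_mul_deriv_eq_deriv_mul hφA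
      have hD : ∫ x in (0 : ℝ)..1, deriv F x * φ x = ∫ x in (0 : ℝ)..1, f.dx x * φ x := by
        apply intervalIntegral.integral_congr_ae
        filter_upwards [hv.ae_hasDerivAt_integral] with x hx hx'
        rw [(hx (uIoc_subset_uIcc hx') 0 (by simp)).deriv]
      rw [hD, hφ0, hφ1, intervalIntegral.integral_of_le zero_le_one,
        intervalIntegral.integral_of_le zero_le_one, integral_Ioc_eq_integral_Ioo,
        integral_Ioc_eq_integral_Ioo] at hI
      simp_rw [sub_mul]
      rw [integral_sub (integrableOn_mul_test (L2.integrableOn _) hd)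
        (integrableOn_mul_test hFi hd), hw.integral_eq φ h1 h2 h3, hI]
      ring)
  refine ⟨fun x => F x + c, hFc.add continuousOn_const, hc.mono fun x hx => ?_⟩
  simp only at hx ⊢
  linarith

/-- The continuous representative of an element of `H¹(0,1)`; its values on `[0,1]`, in
particular the boundary values at `0` and `1`, do not depend on the choice. -/
noncomputable def H1.rep (f : H1) : ℝ → ℝ := Classical.choose f.exists_continuous_rep

theorem H1.rep_continuousOn (f : H1) : ContinuousOn f.rep (Icc 0 1) :=
  (Classical.choose_spec f.exists_continuous_rep).1

theorem H1.ae_eq_rep (f : H1) :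
    (f.toL2 : ℝ → ℝ) =ᵐ[volume.restrict (Ioo (0 : ℝ) 1)] f.rep :=
  (Classical.choose_spec f.exists_continuous_rep).2

/-- Damping laws: `a ∈ W^{3,∞}_loc(ℝ)` (identified with its continuous representative), with
`a(0) = 0`, `a₀ ≤ a' ≤ a₁`, `|a''| ≤ a₂` and `|a'''| ≤ a₃` almost everywhere, the derivatives
being weak ones. The bounds contain the local boundedness of the derivatives, and continuity
contains that of `a`. -/
structure IsDampingLaw (a₀ a₁ a₂ a₃ : ℝ) (a : ℝ → ℝ) : Prop where
  continuous : Continuous a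
  map_zero : a 0 = 0
  weak_derivs : ∃ d₁ d₂ d₃ : ℝ → ℝ,
    HasWeakDeriv univ a d₁ ∧ HasWeakDeriv univ d₁ d₂ ∧ HasWeakDeriv univ d₂ d₃ ∧
    (∀ᵐ ξ, a₀ ≤ d₁ ξ ∧ d₁ ξ ≤ a₁) ∧ (∀ᵐ ξ, |d₂ ξ| ≤ a₂) ∧ (∀ᵐ ξ, |d₃ ξ| ≤ a₃)

/-- Boundary fluxes: `g ∈ C⁴([0,T])` with `g(0) = g'(0) = 0`, and with `|g⁽ᵏ⁾| ≤ M` on `[0,T]` for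
`k = 0, …, 4` (derivatives at the end points are one-sided). -/
structure IsBoundaryFlux (T M : ℝ) (g : ℝ → ℝ) : Prop where
  contDiffOn : ContDiffOn ℝ 4 g (Icc 0 T)
  map_zero : g 0 = 0
  deriv_zero : derivWithin g (Icc 0 T) 0 = 0
  bound : ∀ k ≤ 4, ∀ t ∈ Icc 0 T, |iteratedDerivWithin k g (Icc 0 T) t| ≤ M

/-- The curve `t ↦ (p(t), u(t))` in `L²(0,1) × L²(0,1)`, with the Hilbert space norm. -/
noncomputable def stateL2 (p u : ℝ → H1) (t : ℝ) : WithLp 2 (L2 × L2) :=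
  WithLp.toLp 2 ((p t).toL2, (u t).toL2)

/-- The curve `t ↦ (p(t), u(t))` in `H¹(0,1) × H¹(0,1)`, with the Hilbert space norm. -/
noncomputable def stateH1 (p u : ℝ → H1) (t : ℝ) : WithLp 2 (H1 × H1) :=
  WithLp.toLp 2 (p t, u t)

/-- `(p,u) ∈ C¹([0,T]; L² × L²) ∩ C([0,T]; H¹ × H¹)` is a classical solution of
`∂ₜp + ∂ₓu = 0`, `∂ₜu + ∂ₓp + a(u) = 0` on `(0,1) × (0,T]`, with
`u(0,t) = g₀(t)`, `u(1,t) = g₁(t)`, `p(x,0) = p₀(x)`, `u(x,0) = u₀(x)`.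
The equations hold in `L²(0,1)` for every `t`. Only the values of `p` and `u` at times in `[0,T]`
matter. -/
structure IsClassicalSolution (T : ℝ) (a g₀ g₁ p₀ u₀ : ℝ → ℝ) (p u : ℝ → H1) : Prop where
  continuousOn : ContinuousOn (stateH1 p u) (Icc 0 T)
  contDiffOn : ContDiffOn ℝ 1 (stateL2 p u) (Icc 0 T)
  mass : ∀ t ∈ Ioc 0 T, ∀ᵐ x ∂volume.restrict (Ioo (0 : ℝ) 1),
    (derivWithin (stateL2 p u) (Icc 0 T) t).fst x + (u t).dx x = 0
  momentum : ∀ t ∈ Ioc 0 T, ∀ᵐ x ∂volume.restrict (Ioo (0 : ℝ) 1),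
    (derivWithin (stateL2 p u) (Icc 0 T) t).snd x + (p t).dx x + a ((u t).toL2 x) = 0
  boundary_left : ∀ t ∈ Ioc 0 T, (u t).rep 0 = g₀ t
  boundary_right : ∀ t ∈ Ioc 0 T, (u t).rep 1 = g₁ t
  initial_p : ∀ᵐ x ∂volume.restrict (Ioo (0 : ℝ) 1), (p 0).toL2 x = p₀ x
  initial_u : ∀ᵐ x ∂volume.restrict (Ioo (0 : ℝ) 1), (u 0).toL2 x = u₀ x

/-- The pressure drop `p(0,t) - p(1,t)`. -/
noncomputable def pressureDrop (p : ℝ → H1) (t : ℝ) : ℝ := (p t).rep 0 - (p t).rep 1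

/-- The norm of `C([0,T]; E)`, with value `∞` for unbounded functions. -/
noncomputable def supNorm {E : Type*} [NormedAddCommGroup E] (T : ℝ) (y : ℝ → E) : ℝ≥0∞ :=
  ⨆ t ∈ Icc 0 T, ‖y t‖ₑ

/-- The norm of `C¹([0,T]; E)`. -/
noncomputable def c1Norm {E : Type*} [NormedAddCommGroup E] [NormedSpace ℝ E] (T : ℝ)
    (y : ℝ → E) : ℝ≥0∞ :=
  supNorm T y + supNorm T (derivWithin y (Icc 0 T))

/-- The norm of the Hölder space `C^γ([0,T])`, with value `∞` for functions outside the space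
(for `γ = 0` it is equivalent to the supremum norm). -/
noncomputable def holderNorm (T γ : ℝ) (h : ℝ → ℝ) : ℝ≥0∞ :=
  supNorm T h + ⨆ s ∈ Icc 0 T, ⨆ t ∈ Icc 0 T, ⨆ _ : s ≠ t,
    ENNReal.ofReal (|h s - h t| / |s - t| ^ γ)

end PipeFlow

/-!
The system is hyperbolic with characteristic speeds `±1`, so that it is solved along
characteristics, by a function of class `C¹` up to the boundary; the classical solution in the
sense of `L²` and `H¹` is the one given by that function.

*Reduction to zero boundary values.* Since `gᵢ(0) = gᵢ'(0) = 0`, the fluxes extend by zero to `C¹`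
functions of negative times (`IsBoundaryFlux.exists_causal`). An explicit pair `(P, G)`, built from
waves that are reflected at the ends, takes the boundary and initial values and solves
`Pₜ + Gₓ = 0`, `Gₜ + Pₓ = -(1 - x) a(g₀) - x a(g₁)` (`exists_isLift`). The remainder
`(q, v) = (p - P, u - G)` then satisfies `qₜ + vₓ = 0`, `vₜ + qₓ + F = 0` with
`F = a(G + v) - (1 - x) a(g₀) - x a(g₁)`. At the ends `v = 0`, so that `F` vanishes there as well.
This makes `F` extend to an odd `2`-periodic function of class `C¹` in `x`.

*The integral equation.* With `v` odd and `q` even, `w = q + v` is one wave that travels to the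
right on the circle of length two, driven by `F`. Hence `e = vₓ` solves a Volterra equation whose
right hand side is an integral over time of `Fₓ = a'(G + v) (Gₓ + e) + a(g₀) - a(g₁)` along the two
characteristics. Here `v` is the primitive of `e`. Since `Fₓ` grows linearly in `e`, a solution
obeys a bound by the data alone; since `a'` is bounded and Lipschitz, the equation with `e`
truncated above that bound is solved by contraction in a weighted supremum norm (`exists_slope`).
Conversely, the wave driven by the primitive of `Fₓ` (`exists_wave_of_source`, by Duhamel's
formula) solves the system (`IsLift.exists_solution`). All bounds depend on `a₁`, `a₂`, `M` and `T`
only.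

*Pressure drop.* The function `p` is of class `C¹` up to the boundary, with a bound for `pₜ`, so
the pressure drop is Lipschitz, and a fortiori Hölder continuous with every exponent below `1/2`.

*Uniqueness.* The `L²` norm of the difference of two classical solutions does not increase, because
`a` is monotone and the boundary terms vanish (`IsClassicalSolution.inner_deriv_nonpos`). The
integration by parts in `H¹` rests on `HasWeakDeriv.ae_eq_primitive`, which also shows that a
damping law is a `C¹` function with a Lipschitz derivative.
-/

namespace PipeFlow

/-! ### Continuously differentiable functions of two variables -/

/-- The function `(x, t) ↦ f x t` is of class `C¹` on the plane, with partial derivatives `fx`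
and `ft`. -/
structure HasPartials (f fx ft : ℝ → ℝ → ℝ) : Prop where
  continuous_x : Continuous fun z : ℝ × ℝ => fx z.1 z.2
  continuous_t : Continuous fun z : ℝ × ℝ => ft z.1 z.2
  deriv_x : ∀ x t, HasDerivAt (fun y => f y t) (fx x t) x
  deriv_t : ∀ x t, HasDerivAt (fun s => f x s) (ft x t) t

namespace HasPartials

variable {f fx ft g gx gt : ℝ → ℝ → ℝ}

theorem hasFDerivAt (h : HasPartials f fx ft) (z : ℝ × ℝ) :
    HasFDerivAt (fun z : ℝ × ℝ => f z.1 z.2)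
      ((ContinuousLinearMap.toSpanSingleton ℝ (fx z.1 z.2)).coprod
        (ContinuousLinearMap.toSpanSingleton ℝ (ft z.1 z.2))) z := by
  have hx : Continuous fun z : ℝ × ℝ => ContinuousLinearMap.toSpanSingleton ℝ (fx z.1 z.2) :=
    (ContinuousLinearMap.toSpanSingletonCLE (𝕜 := ℝ) (E := ℝ)).continuous.comp h.continuous_x
  have ht : Continuous fun z : ℝ × ℝ => ContinuousLinearMap.toSpanSingleton ℝ (ft z.1 z.2) :=
    (ContinuousLinearMap.toSpanSingletonCLE (𝕜 := ℝ) (E := ℝ)).continuous.comp h.continuous_t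
  exact (hasStrictFDerivAt_uncurry_coprod (f := f) (u := z)
    (f₁ := fun x t => ContinuousLinearMap.toSpanSingleton ℝ (fx x t))
    (f₂ := fun x t => ContinuousLinearMap.toSpanSingleton ℝ (ft x t))
    (Eventually.of_forall fun v => (h.deriv_x v.1 v.2).hasFDerivAt)
    (Eventually.of_forall fun v => (h.deriv_t v.1 v.2).hasFDerivAt)
    hx.continuousAt ht.continuousAt).hasFDerivAt

theorem continuous (h : HasPartials f fx ft) : Continuous fun z : ℝ × ℝ => f z.1 z.2 :=
  continuous_iff_continuousAt.2 fun z => (h.hasFDerivAt z).continuousAt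

/-- The chain rule along a curve. -/
theorem hasDerivAt_comp (h : HasPartials f fx ft) {x t : ℝ → ℝ} {x' t' s : ℝ}
    (hx : HasDerivAt x x' s) (ht : HasDerivAt t t' s) :
    HasDerivAt (fun r => f (x r) (t r)) (x' * fx (x s) (t s) + t' * ft (x s) (t s)) s := by
  have := (h.hasFDerivAt (x s, t s)).comp_hasDerivAt s (hx.prodMk ht)
  simpa [Function.comp_def] using this

theorem add (hf : HasPartials f fx ft) (hg : HasPartials g gx gt) :
    HasPartials (fun x t => f x t + g x t) (fun x t => fx x t + gx x t)
      (fun x t => ft x t + gt x t) where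
  continuous_x := hf.continuous_x.add hg.continuous_x
  continuous_t := hf.continuous_t.add hg.continuous_t
  deriv_x x t := (hf.deriv_x x t).add (hg.deriv_x x t)
  deriv_t x t := (hf.deriv_t x t).add (hg.deriv_t x t)

theorem const_mul (c : ℝ) (hf : HasPartials f fx ft) :
    HasPartials (fun x t => c * f x t) (fun x t => c * fx x t) (fun x t => c * ft x t) where
  continuous_x := hf.continuous_x.const_mul c
  continuous_t := hf.continuous_t.const_mul c
  deriv_x x t := (hf.deriv_x x t).const_mul c
  deriv_t x t := (hf.deriv_t x t).const_mul c

theorem sub (hf : HasPartials f fx ft) (hg : HasPartials g gx gt) :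
    HasPartials (fun x t => f x t - g x t) (fun x t => fx x t - gx x t)
      (fun x t => ft x t - gt x t) where
  continuous_x := hf.continuous_x.sub hg.continuous_x
  continuous_t := hf.continuous_t.sub hg.continuous_t
  deriv_x x t := (hf.deriv_x x t).sub (hg.deriv_x x t)
  deriv_t x t := (hf.deriv_t x t).sub (hg.deriv_t x t)

/-- Reflection in the space variable. -/
theorem reflect (hf : HasPartials f fx ft) :
    HasPartials (fun x t => f (-x) t) (fun x t => -fx (-x) t) (fun x t => ft (-x) t) where
  continuous_x := (hf.continuous_x.comp (by fun_prop : Continuous fun z : ℝ × ℝ => (-z.1, z.2))).neg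
  continuous_t := hf.continuous_t.comp (by fun_prop : Continuous fun z : ℝ × ℝ => (-z.1, z.2))
  deriv_x x t := by
    simpa using hf.hasDerivAt_comp (hasDerivAt_neg x) (hasDerivAt_const x t)
  deriv_t x t := hf.deriv_t (-x) t

/-- Functions of the form `α (m x + t + l)`, in particular waves travelling with speed `±1`. -/
theorem of_comp_linear {α α' : ℝ → ℝ} (hα' : Continuous α') (h : ∀ s, HasDerivAt α (α' s) s)
    (m l : ℝ) : HasPartials (fun x t => α (m * x + t + l)) (fun x t => m * α' (m * x + t + l))
      (fun x t => α' (m * x + t + l)) where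
  continuous_x := by fun_prop
  continuous_t := by fun_prop
  deriv_x x t := by
    have h1 : HasDerivAt (fun y => m * y + t + l) m x := by
      simpa using (((hasDerivAt_id x).const_mul m).add_const t).add_const l
    simpa [Function.comp_def, mul_comm] using (h (m * x + t + l)).comp x h1
  deriv_t x t := by
    have h1 : HasDerivAt (fun s => m * x + s + l) 1 t := by
      simpa using ((hasDerivAt_id t).const_add (m * x)).add_const l
    simpa [Function.comp_def] using (h (m * x + t + l)).comp t h1

/-- Products of a linear function of `x` with a function of `t`. -/
theorem of_mul_linear {β β' : ℝ → ℝ} (hβ' : Continuous β') (h : ∀ s, HasDerivAt β (β' s) s)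
    (m k : ℝ) : HasPartials (fun x t => (m * x + k) * β t) (fun _ t => m * β t)
      (fun x t => (m * x + k) * β' t) where
  continuous_x := by
    have hβ : Continuous β := continuous_iff_continuousAt.2 fun s => (h s).continuousAt
    fun_prop
  continuous_t := by fun_prop
  deriv_x x t := by
    simpa using (((hasDerivAt_id x).const_mul m).add_const k).mul_const (β t)
  deriv_t x t := (h t).const_mul _

end HasPartials

theorem continuous_integral_of_continuous {X : Type*} [TopologicalSpace X] {h : X → ℝ → ℝ}
    {s₁ s₂ : X → ℝ} (hh : Continuous fun z : X × ℝ => h z.1 z.2) (h₁ : Continuous s₁)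
    (h₂ : Continuous s₂) : Continuous fun z => ∫ s in s₁ z..s₂ z, h z s := by
  have key : ∀ {s : X → ℝ}, Continuous s → Continuous fun z => ∫ r in (0 : ℝ)..s z, h z r :=
    fun hs => intervalIntegral.continuous_parametric_intervalIntegral_of_continuous hh hs
  have e : (fun z => ∫ s in s₁ z..s₂ z, h z s)
      = fun z => (∫ s in (0 : ℝ)..s₂ z, h z s) - ∫ s in (0 : ℝ)..s₁ z, h z s := by
    funext z
    have hz : Continuous (h z) := hh.comp (by fun_prop : Continuous fun r : ℝ => (z, r))
    rw [intervalIntegral.integral_interval_sub_left] <;> exact hz.intervalIntegrable _ _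
  rw [e]
  exact (key h₂).sub (key h₁)

/-- Differentiation under the integral sign. -/
theorem hasDerivAt_integral_of_continuous {h h' : ℝ → ℝ → ℝ}
    (hh : Continuous fun z : ℝ × ℝ => h z.1 z.2) (hh' : Continuous fun z : ℝ × ℝ => h' z.1 z.2)
    (hd : ∀ y s, HasDerivAt (fun y => h y s) (h' y s) y) (a b x : ℝ) :
    HasDerivAt (fun y => ∫ s in a..b, h y s) (∫ s in a..b, h' x s) x := by
  obtain ⟨C, hC⟩ := ((isCompact_closedBall x 1).prod (isCompact_uIcc (a := a) (b := b))
    ).exists_bound_of_continuousOn hh'.continuousOn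
  have c1 : ∀ y, Continuous (h y) := fun y => hh.comp (by fun_prop : Continuous fun r : ℝ => (y, r))
  have c2 : ∀ y, Continuous (h' y) :=
    fun y => hh'.comp (by fun_prop : Continuous fun r : ℝ => (y, r))
  refine (intervalIntegral.hasDerivAt_integral_of_dominated_loc_of_deriv_le
    (F := h) (F' := h') (bound := fun _ => C)
    (Metric.closedBall_mem_nhds x one_pos) (Eventually.of_forall fun y =>
      (c1 y).aestronglyMeasurable) ((c1 x).intervalIntegrable _ _)
    (c2 x).aestronglyMeasurable ?_ (by simp) ?_).2
  · exact Eventually.of_forall fun s hs y hy => hC (y, s) ⟨hy, uIoc_subset_uIcc hs⟩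
  · exact Eventually.of_forall fun s _ y _ => hd y s

/-- Duhamel's formula: `w` solves the transport equation `wₜ + wₓ + n = 0` with zero initial
values, where `n` is the primitive of `ψ` in the space variable that vanishes at `x = 0`. -/
theorem hasPartials_duhamel {ψ : ℝ → ℝ → ℝ} (hψ : Continuous fun z : ℝ × ℝ => ψ z.1 z.2) :
    HasPartials (fun x t => -∫ s in (0 : ℝ)..t, ∫ y in (0 : ℝ)..(x - t + s), ψ y s)
      (fun x t => -∫ s in (0 : ℝ)..t, ψ (x - t + s) s)
      (fun x t => (∫ s in (0 : ℝ)..t, ψ (x - t + s) s) - ∫ y in (0 : ℝ)..x, ψ y t) := by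
  have hn : Continuous fun z : ℝ × ℝ => ∫ y in (0 : ℝ)..z.1, ψ y z.2 :=
    continuous_integral_of_continuous
      (hψ.comp (by fun_prop : Continuous fun z : (ℝ × ℝ) × ℝ => (z.2, z.1.2)))
      continuous_const continuous_fst
  have hψ1 : ∀ s, Continuous fun y => ψ y s := fun s =>
    hψ.comp (by fun_prop : Continuous fun y : ℝ => (y, s))
  have hnd : ∀ s y, HasDerivAt (fun y => ∫ r in (0 : ℝ)..y, ψ r s) (ψ y s) y := fun s y =>
    intervalIntegral.integral_hasDerivAt_right ((hψ1 s).intervalIntegrable _ _)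
      ((hψ1 s).stronglyMeasurableAtFilter _ _) (hψ1 s).continuousAt
  have hsh : Continuous fun z : ℝ × ℝ => ∫ y in (0 : ℝ)..(z.1 + z.2), ψ y z.2 :=
    hn.comp (by fun_prop : Continuous fun z : ℝ × ℝ => (z.1 + z.2, z.2))
  have hshd : Continuous fun z : ℝ × ℝ => ψ (z.1 + z.2) z.2 :=
    hψ.comp (by fun_prop : Continuous fun z : ℝ × ℝ => (z.1 + z.2, z.2))
  -- In characteristic coordinates the two partial derivatives are read off separately.
  have hZ : HasPartials (fun y t => ∫ s in (0 : ℝ)..t, ∫ r in (0 : ℝ)..(y + s), ψ r s)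
      (fun y t => ∫ s in (0 : ℝ)..t, ψ (y + s) s) (fun y t => ∫ r in (0 : ℝ)..(y + t), ψ r t) :=
    { continuous_x := continuous_integral_of_continuous
        (hshd.comp (by fun_prop : Continuous fun z : (ℝ × ℝ) × ℝ => (z.1.1, z.2)))
        continuous_const continuous_snd
      continuous_t := hsh
      deriv_x := fun y t => hasDerivAt_integral_of_continuous hsh hshd
        (fun y s => by
          have := (hnd s (y + s)).comp y ((hasDerivAt_id y).add_const s)
          simpa [Function.comp_def] using this) 0 t y
      deriv_t := fun y t => by
        have c : Continuous fun s => ∫ r in (0 : ℝ)..(y + s), ψ r s :=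
          hsh.comp (by fun_prop : Continuous fun s : ℝ => (y, s))
        exact intervalIntegral.integral_hasDerivAt_right (c.intervalIntegrable _ _)
          (c.stronglyMeasurableAtFilter _ _) c.continuousAt }
  have hsub : Continuous fun z : ℝ × ℝ => (z.1 - z.2, z.2) := by fun_prop
  refine ⟨(hZ.continuous_x.comp hsub).neg, (hZ.continuous_x.comp hsub).sub hn, fun x t => ?_,
    fun x t => ?_⟩
  · have := (hZ.hasDerivAt_comp ((hasDerivAt_id x).sub_const t) (hasDerivAt_const x t)).fun_neg
    simpa using this
  · have := (hZ.hasDerivAt_comp ((hasDerivAt_id t).const_sub x) (hasDerivAt_id t)).fun_neg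
    simp only [id, sub_add_cancel] at this
    exact this.congr_deriv (by ring)

/-! ### Weak derivatives in one dimension -/

theorem HasWeakDeriv.restrict_Ioo {f v : ℝ → ℝ} (h : HasWeakDeriv univ f v) (α β : ℝ) :
    HasWeakDeriv (Ioo α β) f v where
  locInt := h.locInt.mono_set (subset_univ _)
  locInt_deriv := h.locInt_deriv.mono_set (subset_univ _)
  integral_eq φ h1 h2 h3 := by
    have := h.integral_eq φ h1 h2 (subset_univ _)
    rw [setIntegral_eq_integral_of_forall_compl_eq_zero,
      setIntegral_eq_integral_of_forall_compl_eq_zero]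
    · simpa using this
    · intro x hx
      rw [image_eq_zero_of_notMem_tsupport fun h' => hx (h3 h'), mul_zero]
    · intro x hx
      rw [image_eq_zero_of_notMem_tsupport fun h' => hx (h3 (tsupport_deriv_subset h')), mul_zero]

/-- On a bounded interval, an integrable function with an integrable weak derivative is a
primitive of that derivative. The case of the unit interval is `ae_eq_const_of_test`, applied to
the rescaled difference of the function and the primitive. -/
theorem HasWeakDeriv.ae_eq_primitive {α β : ℝ} (hαβ : α < β) {f v : ℝ → ℝ}
    (h : HasWeakDeriv (Ioo α β) f v) (hf : IntegrableOn f (Ioo α β))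
    (hv : IntegrableOn v (Ioo α β)) :
    ∃ c : ℝ, ∀ᵐ x, x ∈ Ioo α β → f x = c + ∫ y in α..x, v y := by
  have hvi : IntervalIntegrable v volume α β :=
    (intervalIntegrable_iff_integrableOn_Ioo_of_le hαβ.le).2 hv
  let F : ℝ → ℝ := fun x => ∫ y in α..x, v y
  have hF : AbsolutelyContinuousOnInterval F α β :=
    hvi.absolutelyContinuousOnInterval_intervalIntegral (by simp)
  have hFc : ContinuousOn F (Icc α β) := by
    simpa [uIcc_of_le hαβ.le] using hF.continuousOn
  have hFi : IntegrableOn F (Ioo α β) :=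
    (hFc.integrableOn_compact isCompact_Icc).mono_set Ioo_subset_Icc_self
  have hℓ : 0 < β - α := sub_pos.2 hαβ
  have hgi : IntervalIntegrable (fun x => f x - F x) volume α β :=
    (intervalIntegrable_iff_integrableOn_Ioo_of_le hαβ.le).2 (hf.sub hFi)
  have hgs : IntegrableOn (fun x => f (α + (β - α) * x) - F (α + (β - α) * x))
      (Ioo (0 : ℝ) 1) := by
    rw [← intervalIntegrable_iff_integrableOn_Ioo_of_le zero_le_one]
    have := (hgi.comp_add_left α).comp_mul_left (c := β - α)
    simpa [hℓ.ne'] using this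
  obtain ⟨c, hc⟩ := ae_eq_const_of_test hgs (fun φ h1 h2 h3 => by
    -- The test function is transported to the given interval.
    let χ : ℝ → ℝ := fun y => φ ((y - α) / (β - α))
    have hχ : ContDiff ℝ ∞ χ := h1.comp (by fun_prop)
    let e : ℝ ≃ₜ ℝ := (Homeomorph.addRight (-α)).trans
      (Homeomorph.mulRight₀ (β - α)⁻¹ (inv_ne_zero hℓ.ne'))
    have he : χ = φ ∘ e := by
      funext y
      simp [χ, e, div_eq_mul_inv, sub_eq_add_neg]
    have hχc : HasCompactSupport χ := he ▸ h2.comp_homeomorph e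
    have hχt : tsupport χ ⊆ Ioo α β := by
      intro y hy
      have h4 : e y ∈ tsupport φ := by
        rw [he] at hy
        exact tsupport_comp_subset_preimage φ e.continuous hy
      have h5 : (y - α) / (β - α) ∈ Ioo (0 : ℝ) 1 := by
        have := h3 h4
        simpa [e, div_eq_mul_inv, sub_eq_add_neg] using this
      have h6 := (lt_div_iff₀ hℓ).1 h5.1
      have h7 := (div_lt_iff₀ hℓ).1 h5.2
      constructor <;> linarith
    have hχd : ∀ x, deriv χ (α + (β - α) * x) = (β - α)⁻¹ * deriv φ x := by
      intro x
      have h8 : HasDerivAt φ (deriv φ x) ((α + (β - α) * x - α) / (β - α)) := by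
        rw [add_sub_cancel_left, mul_div_cancel_left₀ _ hℓ.ne']
        exact (h1.differentiable (by simp) x).hasDerivAt
      have h9 := h8.comp (α + (β - α) * x)
        (((hasDerivAt_id (α + (β - α) * x)).sub_const α).div_const (β - α))
      have h10 : HasDerivAt χ (deriv φ x * (1 / (β - α))) (α + (β - α) * x) := h9
      rw [h10.deriv]
      ring
    have hd : Continuous (deriv χ) := hχ.continuous_deriv (by simp)
    have hχα : χ α = 0 := image_eq_zero_of_notMem_tsupport fun h => by simpa using hχt h
    have hχβ : χ β = 0 := image_eq_zero_of_notMem_tsupport fun h => by simpa using hχt h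
    have hχA : AbsolutelyContinuousOnInterval χ α β :=
      ((hχ.of_le (by simp)).contDiffOn).absolutelyContinuousOnInterval
    have hI := hF.integral_mul_deriv_eq_deriv_mul hχA
    have hD : ∫ x in α..β, deriv F x * χ x = ∫ x in α..β, v x * χ x := by
      apply intervalIntegral.integral_congr_ae
      filter_upwards [hvi.ae_hasDerivAt_integral] with x hx hx'
      rw [(hx (uIoc_subset_uIcc hx') α (by simp)).deriv]
    have hW := h.integral_eq χ hχ hχc hχt
    rw [← integral_Ioc_eq_integral_Ioo, ← integral_Ioc_eq_integral_Ioo,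
      ← intervalIntegral.integral_of_le hαβ.le, ← intervalIntegral.integral_of_le hαβ.le] at hW
    rw [hD, hχα, hχβ] at hI
    have hfi : IntervalIntegrable f volume α β :=
      (intervalIntegrable_iff_integrableOn_Ioo_of_le hαβ.le).2 hf
    have hFi' : IntervalIntegrable F volume α β :=
      (intervalIntegrable_iff_integrableOn_Ioo_of_le hαβ.le).2 hFi
    have hz : ∫ y in α..β, (f y - F y) * deriv χ y = 0 := by
      simp_rw [sub_mul]
      rw [intervalIntegral.integral_sub (hfi.mul_continuousOn hd.continuousOn)
        (hFi'.mul_continuousOn hd.continuousOn), hW, hI]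
      ring
    have hs := intervalIntegral.integral_comp_add_mul
      (fun y => (f y - F y) * deriv χ y) (a := 0) (b := 1) hℓ.ne' α
    rw [mul_zero, add_zero, mul_one, add_sub_cancel, hz, smul_zero] at hs
    simp only [hχd] at hs
    rw [← integral_Ioc_eq_integral_Ioo, ← intervalIntegral.integral_of_le zero_le_one]
    have e1 : ∀ x, (f (α + (β - α) * x) - F (α + (β - α) * x)) * ((β - α)⁻¹ * deriv φ x)
        = (β - α)⁻¹ * ((f (α + (β - α) * x) - F (α + (β - α) * x)) * deriv φ x) :=
      fun x => by ring
    simp only [e1] at hs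
    rw [intervalIntegral.integral_const_mul] at hs
    exact (mul_eq_zero.1 hs).resolve_left (inv_ne_zero hℓ.ne'))
  refine ⟨c, ?_⟩
  have hq : Measure.QuasiMeasurePreserving (fun y : ℝ => (y - α) * (β - α)⁻¹) volume volume := by
    refine Measure.QuasiMeasurePreserving.comp (g := fun y : ℝ => y * (β - α)⁻¹)
      (μb := volume) ⟨by fun_prop, ?_⟩ (measurePreserving_sub_right volume α).quasiMeasurePreserving
    rw [Real.map_volume_mul_right (inv_ne_zero hℓ.ne')]
    exact Measure.smul_absolutelyContinuous
  have hc' := (ae_restrict_iff' measurableSet_Ioo).1 hc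
  filter_upwards [hq.ae hc'] with y hy hy'
  have h0 : (y - α) * (β - α)⁻¹ ∈ Ioo (0 : ℝ) 1 := by
    rw [← div_eq_mul_inv]
    exact ⟨div_pos (sub_pos.2 hy'.1) hℓ, (div_lt_one hℓ).2 (by linarith [hy'.2])⟩
  have := hy h0
  have e2 : α + (β - α) * ((y - α) * (β - α)⁻¹) = y := by
    field_simp
    ring
  rw [e2] at this
  simp only [F] at this
  linarith

theorem HasWeakDeriv.ae_eq_primitive_univ {f v : ℝ → ℝ} (h : HasWeakDeriv univ f v) :
    ∃ c : ℝ, ∀ᵐ x, f x = c + ∫ y in (0 : ℝ)..x, v y := by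
  have hfl : LocallyIntegrable f := locallyIntegrableOn_univ.1 h.locInt
  have hvl : LocallyIntegrable v := locallyIntegrableOn_univ.1 h.locInt_deriv
  have hvi : ∀ a b, IntervalIntegrable v volume a b := fun a b =>
    (hvl.integrableOn_isCompact isCompact_uIcc).intervalIntegrable
  have key : ∀ n : ℕ, ∃ c : ℝ, ∀ᵐ x, x ∈ Ioo (-(n + 1 : ℝ)) (n + 1) →
      f x = c + ∫ y in (0 : ℝ)..x, v y := by
    intro n
    have hn : (-(n + 1 : ℝ)) < n + 1 := by
      have : (0 : ℝ) ≤ n := n.cast_nonneg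
      linarith
    obtain ⟨c, hc⟩ := (h.restrict_Ioo (-(n + 1 : ℝ)) (n + 1)).ae_eq_primitive hn
      ((hfl.integrableOn_isCompact isCompact_Icc).mono_set Ioo_subset_Icc_self)
      ((hvl.integrableOn_isCompact isCompact_Icc).mono_set Ioo_subset_Icc_self)
    refine ⟨c + ∫ y in (-(n + 1 : ℝ))..0, v y, ?_⟩
    filter_upwards [hc] with x hx hx'
    rw [hx hx', add_assoc, intervalIntegral.integral_add_adjacent_intervals (hvi _ _) (hvi _ _)]
  choose c hc using key
  have hcc : ∀ n, c n = c 0 := by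
    intro n
    have h2 : ∀ᵐ x ∂volume.restrict (Ioo (-1 : ℝ) 1), c n = c 0 := by
      rw [ae_restrict_iff' measurableSet_Ioo]
      filter_upwards [hc n, hc 0] with x hx hx0 hx'
      have hn : (0 : ℝ) ≤ n := n.cast_nonneg
      have h3 := hx ⟨by linarith [hx'.1], by linarith [hx'.2]⟩
      have h4 := hx0 (by simpa using hx')
      linarith
    have : (ae (volume.restrict (Ioo (-1 : ℝ) 1))).NeBot := by
      rw [ae_neBot, Ne, Measure.restrict_eq_zero]
      simp
    exact h2.exists.choose_spec
  refine ⟨c 0, ?_⟩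
  filter_upwards [ae_all_iff.2 hc] with x hx
  obtain ⟨n, hn⟩ := exists_nat_gt |x|
  have := hx n ⟨by linarith [neg_abs_le x], by linarith [le_abs_self x]⟩
  rwa [hcc n] at this

/-! ### Damping laws and boundary fluxes as globally defined `C¹` functions -/

/-- The properties of a damping law `a`, with derivative `D`, on which the construction of the
solution rests. -/
structure IsRegularDamping (a₁ a₂ : ℝ) (a D : ℝ → ℝ) : Prop where
  continuous_deriv : Continuous D
  hasDerivAt : ∀ ξ, HasDerivAt a (D ξ) ξ
  map_zero : a 0 = 0
  deriv_nonneg : ∀ ξ, 0 ≤ D ξ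
  deriv_le : ∀ ξ, D ξ ≤ a₁
  lipschitz_deriv : ∀ ξ η, |D ξ - D η| ≤ a₂ * |ξ - η|

namespace IsRegularDamping

variable {a₁ a₂ : ℝ} {a D : ℝ → ℝ}

theorem continuous (h : IsRegularDamping a₁ a₂ a D) : Continuous a :=
  continuous_iff_continuousAt.2 fun t => (h.hasDerivAt t).continuousAt

theorem monotone (h : IsRegularDamping a₁ a₂ a D) : Monotone a :=
  monotone_of_hasDerivAt_nonneg h.hasDerivAt h.deriv_nonneg

theorem abs_deriv_le (h : IsRegularDamping a₁ a₂ a D) (ξ : ℝ) : |D ξ| ≤ a₁ := by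
  rw [abs_of_nonneg (h.deriv_nonneg ξ)]
  exact h.deriv_le ξ

theorem abs_le (h : IsRegularDamping a₁ a₂ a D) (ξ : ℝ) : |a ξ| ≤ a₁ * |ξ| := by
  have := convex_univ.norm_image_sub_le_of_norm_hasDerivWithin_le (f := a) (f' := D) (C := a₁)
    (fun x _ => (h.hasDerivAt x).hasDerivWithinAt) (fun x _ => h.abs_deriv_le x)
    (mem_univ 0) (mem_univ ξ)
  simpa [h.map_zero] using this

end IsRegularDamping

theorem IsDampingLaw.exists_isRegularDamping {a₀ a₁ a₂ a₃ : ℝ} (ha₀ : 0 < a₀) {a : ℝ → ℝ}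
    (h : IsDampingLaw a₀ a₁ a₂ a₃ a) : ∃ D : ℝ → ℝ, IsRegularDamping a₁ a₂ a D := by
  obtain ⟨d₁, d₂, d₃, h1, h2, -, hb1, hb2, -⟩ := h.weak_derivs
  obtain ⟨c₁, hc₁⟩ := h1.ae_eq_primitive_univ
  obtain ⟨c₂, hc₂⟩ := h2.ae_eq_primitive_univ
  have hi2 : ∀ x y, IntervalIntegrable d₂ volume x y := fun x y =>
    ((locallyIntegrableOn_univ.1 h2.locInt_deriv).integrableOn_isCompact
      isCompact_uIcc).intervalIntegrable
  let D : ℝ → ℝ := fun x => c₂ + ∫ y in (0 : ℝ)..x, d₂ y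
  have hLip : ∀ ξ η, |D ξ - D η| ≤ a₂ * |ξ - η| := by
    intro ξ η
    have e : D ξ - D η = ∫ y in η..ξ, d₂ y := by
      simp only [D]
      rw [add_sub_add_left_eq_sub, intervalIntegral.integral_interval_sub_left (hi2 _ _) (hi2 _ _)]
    rw [e, ← Real.norm_eq_abs]
    exact intervalIntegral.norm_integral_le_of_norm_le_const_ae
      (hb2.mono fun y hy _ => by rwa [Real.norm_eq_abs])
  have hD : Continuous D := by
    have : LipschitzWith (Real.toNNReal a₂) D := LipschitzWith.of_dist_le_mul fun ξ η => by
      rw [Real.dist_eq, Real.dist_eq]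
      exact (hLip ξ η).trans (mul_le_mul_of_nonneg_right (Real.le_coe_toNNReal a₂) (abs_nonneg _))
    exact this.continuous
  have ha : a = fun x => c₁ + ∫ y in (0 : ℝ)..x, D y := by
    have hpr : Continuous fun x => c₁ + ∫ y in (0 : ℝ)..x, D y :=
      continuous_const.add (intervalIntegral.continuous_primitive
        (fun a b => hD.intervalIntegrable a b) 0)
    refine (h.continuous.ae_eq_iff_eq volume hpr).1 ?_
    filter_upwards [hc₁] with x hx
    rw [hx]
    congr 1
    exact intervalIntegral.integral_congr_ae (hc₂.mono fun y hy _ => hy)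
  have hb : ∀ ξ, D ξ ∈ Icc a₀ a₁ := by
    intro ξ
    have hae : ∀ᵐ x, D x ∈ Icc a₀ a₁ := by
      filter_upwards [hc₂, hb1] with x hx hx'
      rw [hx] at hx'
      exact hx'
    have hcl : closure {x | D x ∈ Icc a₀ a₁} = univ :=
      (Measure.dense_of_ae hae).closure_eq
    have : closure {x | D x ∈ Icc a₀ a₁} = {x | D x ∈ Icc a₀ a₁} :=
      (isClosed_Icc.preimage hD).closure_eq
    have h3 : ξ ∈ {x | D x ∈ Icc a₀ a₁} := by
      rw [← this, hcl]
      trivial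
    exact h3
  refine ⟨D, hD, fun ξ => ?_, h.map_zero, fun ξ => ha₀.le.trans (hb ξ).1, fun ξ => (hb ξ).2, hLip⟩
  rw [ha]
  exact (intervalIntegral.integral_hasDerivAt_right (hD.intervalIntegrable _ _)
    (hD.stronglyMeasurableAtFilter _ _) hD.continuousAt).const_add c₁

/-- A function `γ` of class `C¹` on the line, with derivative `γ'`, that vanishes at negative times.
Both functions are bounded by `B` on `(-∞, T]`; there is no bound after the time `T`. -/
structure IsCausal (T B : ℝ) (γ γ' : ℝ → ℝ) : Prop where
  continuous_deriv : Continuous γ'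
  hasDerivAt : ∀ t, HasDerivAt γ (γ' t) t
  eq_zero : ∀ t ≤ 0, γ t = 0
  bound : ∀ t ≤ T, |γ t| ≤ B
  bound_deriv : ∀ t ≤ T, |γ' t| ≤ B

theorem IsCausal.continuous {T B : ℝ} {γ γ' : ℝ → ℝ} (h : IsCausal T B γ γ') : Continuous γ :=
  continuous_iff_continuousAt.2 fun t => (h.hasDerivAt t).continuousAt

/-- The compatibility conditions allow to extend a boundary flux by zero to negative times. After
the final time it is extended linearly. -/
theorem IsBoundaryFlux.exists_causal {T M : ℝ} (hT : 0 < T) (hM : 0 ≤ M) {g : ℝ → ℝ}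
    (h : IsBoundaryFlux T M g) :
    ∃ γ γ' : ℝ → ℝ, IsCausal T (M * (1 + T)) γ γ' ∧ ∀ t ∈ Icc 0 T, γ t = g t := by
  have hu : UniqueDiffOn ℝ (Icc 0 T) := uniqueDiffOn_Icc hT
  let d : ℝ → ℝ := derivWithin g (Icc 0 T)
  have hd : ContinuousOn d (Icc 0 T) := h.contDiffOn.continuousOn_derivWithin hu (by norm_num)
  let γ' : ℝ → ℝ := IccExtend hT.le ((Icc 0 T).domRestrict d)
  have hγ' : Continuous γ' := (continuousOn_iff_continuous_domRestrict.1 hd).Icc_extend'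
  have hγ'M : ∀ t, |γ' t| ≤ M := fun t => by
    have := h.bound 1 (by norm_num) (projIcc 0 T hT.le t) (projIcc 0 T hT.le t).2
    rwa [iteratedDerivWithin_one] at this
  have hγ'0 : ∀ t ≤ 0, γ' t = 0 := fun t ht => by
    simp only [γ', IccExtend_of_le_left hT.le _ ht]
    exact h.deriv_zero
  let γ : ℝ → ℝ := fun t => ∫ s in (0 : ℝ)..t, γ' s
  have hγd : ∀ t, HasDerivAt γ (γ' t) t := fun t =>
    intervalIntegral.integral_hasDerivAt_right (hγ'.intervalIntegrable _ _)
      (hγ'.stronglyMeasurableAtFilter _ _) hγ'.continuousAt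
  have hγ0 : ∀ t ≤ 0, γ t = 0 := fun t ht => by
    apply intervalIntegral.integral_zero_ae
    refine Eventually.of_forall fun s hs => hγ'0 s ?_
    rw [uIoc_of_ge ht] at hs
    exact hs.2
  refine ⟨γ, γ', ⟨hγ', hγd, hγ0, fun t ht => ?_, fun t _ => (hγ'M t).trans ?_⟩,
    fun t ht => ?_⟩
  · rcases le_total t 0 with h0 | h0
    · rw [hγ0 t h0, abs_zero]
      positivity
    · have := intervalIntegral.norm_integral_le_of_norm_le_const (f := γ') (a := 0) (b := t)
        fun s _ => hγ'M s
      rw [← Real.norm_eq_abs (γ t)]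
      rw [sub_zero, abs_of_nonneg h0] at this
      nlinarith
  · nlinarith
  · have hcont : ContinuousOn g (Icc 0 t) :=
      h.contDiffOn.continuousOn.mono (Icc_subset_Icc_right ht.2)
    have := intervalIntegral.integral_eq_sub_of_hasDerivAt_of_le ht.1 hcont (f' := γ')
      (fun s hs => by
        have hs' : s ∈ Icc 0 T := ⟨hs.1.le, hs.2.le.trans ht.2⟩
        have h1 : γ' s = d s := IccExtend_of_mem hT.le _ hs'
        rw [h1]
        exact ((h.contDiffOn.differentiableOn (by norm_num) s hs').hasDerivWithinAt).hasDerivAt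
          (Icc_mem_nhds hs.1 (hs.2.trans_le ht.2)))
      (hγ'.intervalIntegrable _ _)
    simp only [γ]
    rw [this, h.map_zero, sub_zero]

namespace IsCausal

variable {T B B' : ℝ} {γ γ' δ δ' : ℝ → ℝ}

theorem bound_nonneg (h : IsCausal T B γ γ') : 0 ≤ B :=
  (abs_nonneg _).trans (h.bound T le_rfl)

theorem zero (T : ℝ) : IsCausal T 0 (fun _ => 0) (fun _ => 0) :=
  ⟨continuous_const, fun t => hasDerivAt_const t 0, by simp, by simp, by simp⟩

theorem add (h : IsCausal T B γ γ') (h' : IsCausal T B' δ δ') :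
    IsCausal T (B + B') (fun t => γ t + δ t) (fun t => γ' t + δ' t) where
  continuous_deriv := h.continuous_deriv.add h'.continuous_deriv
  hasDerivAt t := (h.hasDerivAt t).add (h'.hasDerivAt t)
  eq_zero t ht := by rw [h.eq_zero t ht, h'.eq_zero t ht, add_zero]
  bound t ht := (abs_add_le _ _).trans (add_le_add (h.bound t ht) (h'.bound t ht))
  bound_deriv t ht :=
    (abs_add_le _ _).trans (add_le_add (h.bound_deriv t ht) (h'.bound_deriv t ht))

theorem neg (h : IsCausal T B γ γ') : IsCausal T B (fun t => -γ t) (fun t => -γ' t) where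
  continuous_deriv := h.continuous_deriv.neg
  hasDerivAt t := (h.hasDerivAt t).neg
  eq_zero t ht := by rw [h.eq_zero t ht, neg_zero]
  bound t ht := by simpa using h.bound t ht
  bound_deriv t ht := by simpa using h.bound_deriv t ht

/-- Delaying a causal function. -/
theorem delay (h : IsCausal T B γ γ') {r : ℝ} (hr : 0 ≤ r) :
    IsCausal T B (fun t => γ (t - r)) (fun t => γ' (t - r)) where
  continuous_deriv := h.continuous_deriv.comp (by fun_prop)
  hasDerivAt t := (h.hasDerivAt (t - r)).comp_sub_const t r
  eq_zero t ht := h.eq_zero _ (by linarith)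
  bound t ht := h.bound _ (by linarith)
  bound_deriv t ht := h.bound_deriv _ (by linarith)

/-- The time integral of the damping along a causal function. -/
theorem integral_damping (h : IsCausal T B γ γ') (hT : 0 < T) {a₁ a₂ : ℝ} {a D : ℝ → ℝ}
    (ha : IsRegularDamping a₁ a₂ a D) :
    IsCausal T (a₁ * B * (1 + T)) (fun t => ∫ s in (0 : ℝ)..t, a (γ s)) (fun t => a (γ t)) := by
  have hc : Continuous fun t => a (γ t) := ha.continuous.comp h.continuous
  have h0 : ∀ t ≤ 0, a (γ t) = 0 := fun t ht => by rw [h.eq_zero t ht, ha.map_zero]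
  have ha₁ : 0 ≤ a₁ := (ha.deriv_nonneg 0).trans (ha.deriv_le 0)
  have hB := h.bound_nonneg
  have hb : ∀ t ≤ T, |a (γ t)| ≤ a₁ * B := fun t ht =>
    (ha.abs_le _).trans (mul_le_mul_of_nonneg_left (h.bound t ht) ha₁)
  have hI0 : ∀ t ≤ 0, ∫ s in (0 : ℝ)..t, a (γ s) = 0 := fun t ht => by
    apply intervalIntegral.integral_zero_ae
    refine Eventually.of_forall fun s hs => h0 s ?_
    rw [uIoc_of_ge ht] at hs
    exact hs.2
  have hp : 0 ≤ a₁ * B := mul_nonneg ha₁ hB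
  refine ⟨hc, fun t => intervalIntegral.integral_hasDerivAt_right (hc.intervalIntegrable _ _)
      (hc.stronglyMeasurableAtFilter _ _) hc.continuousAt, hI0, fun t ht => ?_,
    fun t ht => (hb t ht).trans ?_⟩
  · rcases le_total t 0 with h1 | h1
    · rw [hI0 t h1, abs_zero]
      positivity
    · have := intervalIntegral.norm_integral_le_of_norm_le_const (f := fun s => a (γ s)) (a := 0)
        (b := t) (C := a₁ * B) fun s hs => hb s (by
          rw [uIoc_of_le h1] at hs
          exact hs.2.trans ht)
      rw [sub_zero, abs_of_nonneg h1, Real.norm_eq_abs] at this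
      refine this.trans ?_
      exact mul_le_mul_of_nonneg_left (by linarith) hp
  · nlinarith

/-- The outgoing wave profile of the wave equation with the fluxes `γ` and `δ` prescribed at the
two ends: a signal returns to the left end after two units of time, having met the right end
halfway. The recursion terminates since all functions vanish at negative times. -/
theorem exists_reflection (h : IsCausal T B γ γ') (h' : IsCausal T B δ δ') (N : ℕ) :
    ∃ α α' : ℝ → ℝ, IsCausal T (N * (2 * B)) α α' ∧
      ∀ t : ℝ, t ≤ 2 * N → α t = α (t - 2) + γ t - δ (t - 1) := by
  induction N with
  | zero =>
    refine ⟨fun _ => 0, fun _ => 0, by simpa using zero T, fun t ht => ?_⟩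
    have ht' : t ≤ 0 := by simpa using ht
    simp [h.eq_zero t ht', h'.eq_zero (t - 1) (by linarith)]
  | succ N ih =>
    obtain ⟨α, α', hα, hr⟩ := ih
    refine ⟨fun t => α (t - 2) + (γ t + -δ (t - 1)), fun t => α' (t - 2) + (γ' t + -δ' (t - 1)),
      ?_, fun t ht => ?_⟩
    · convert (hα.delay zero_le_two).add (h.add (h'.delay zero_le_one).neg) using 1
      push_cast
      ring
    · have h1 := hr (t - 2) (by push_cast at ht; linarith)
      simp only
      rw [h1]
      ring

end IsCausal

/-! ### Lifting the boundary data -/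

/-- A `C¹` function on the plane that is bounded by `K` on `[0,1] × [0,T]`, together with its
partial derivatives. -/
structure HasBoundedPartials (T K : ℝ) (f fx ft : ℝ → ℝ → ℝ) : Prop extends
    HasPartials f fx ft where
  bound : ∀ x ∈ Icc (0 : ℝ) 1, ∀ t ∈ Icc 0 T, |f x t| ≤ K
  bound_x : ∀ x ∈ Icc (0 : ℝ) 1, ∀ t ∈ Icc 0 T, |fx x t| ≤ K
  bound_t : ∀ x ∈ Icc (0 : ℝ) 1, ∀ t ∈ Icc 0 T, |ft x t| ≤ K

namespace HasBoundedPartials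

variable {T K K' : ℝ} {f fx ft g gx gt : ℝ → ℝ → ℝ}

theorem mono (h : HasBoundedPartials T K f fx ft) (hK : K ≤ K') :
    HasBoundedPartials T K' f fx ft :=
  ⟨h.toHasPartials, fun x hx t ht => (h.bound x hx t ht).trans hK,
    fun x hx t ht => (h.bound_x x hx t ht).trans hK,
    fun x hx t ht => (h.bound_t x hx t ht).trans hK⟩

theorem add (hf : HasBoundedPartials T K f fx ft) (hg : HasBoundedPartials T K' g gx gt) :
    HasBoundedPartials T (K + K') (fun x t => f x t + g x t) (fun x t => fx x t + gx x t)
      (fun x t => ft x t + gt x t) where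
  toHasPartials := hf.toHasPartials.add hg.toHasPartials
  bound x hx t ht := (abs_add_le _ _).trans (add_le_add (hf.bound x hx t ht) (hg.bound x hx t ht))
  bound_x x hx t ht :=
    (abs_add_le _ _).trans (add_le_add (hf.bound_x x hx t ht) (hg.bound_x x hx t ht))
  bound_t x hx t ht :=
    (abs_add_le _ _).trans (add_le_add (hf.bound_t x hx t ht) (hg.bound_t x hx t ht))

theorem sub (hf : HasBoundedPartials T K f fx ft) (hg : HasBoundedPartials T K' g gx gt) :
    HasBoundedPartials T (K + K') (fun x t => f x t - g x t) (fun x t => fx x t - gx x t)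
      (fun x t => ft x t - gt x t) where
  toHasPartials := hf.toHasPartials.sub hg.toHasPartials
  bound x hx t ht := (abs_sub _ _).trans (add_le_add (hf.bound x hx t ht) (hg.bound x hx t ht))
  bound_x x hx t ht :=
    (abs_sub _ _).trans (add_le_add (hf.bound_x x hx t ht) (hg.bound_x x hx t ht))
  bound_t x hx t ht :=
    (abs_sub _ _).trans (add_le_add (hf.bound_t x hx t ht) (hg.bound_t x hx t ht))

theorem const (c : ℝ) : HasBoundedPartials T |c| (fun _ _ => c) (fun _ _ => 0) (fun _ _ => 0) where
  continuous_x := continuous_const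
  continuous_t := continuous_const
  deriv_x x _ := hasDerivAt_const x c
  deriv_t _ t := hasDerivAt_const t c
  bound := by simp
  bound_x := by simp
  bound_t := by simp

/-- Waves that leave the left end. -/
theorem right_wave {B : ℝ} {α α' : ℝ → ℝ} (h : IsCausal T B α α') :
    HasBoundedPartials T B (fun x t => α (-1 * x + t + 0)) (fun x t => -1 * α' (-1 * x + t + 0))
      (fun x t => α' (-1 * x + t + 0)) where
  toHasPartials := HasPartials.of_comp_linear h.continuous_deriv h.hasDerivAt _ _
  bound x hx t ht := h.bound _ (by linarith [hx.1, ht.2])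
  bound_x x hx t ht := by
    rw [abs_mul, abs_neg, abs_one, one_mul]
    exact h.bound_deriv _ (by linarith [hx.1, ht.2])
  bound_t x hx t ht := h.bound_deriv _ (by linarith [hx.1, ht.2])

/-- Waves that leave the right end. -/
theorem left_wave {B : ℝ} {β β' : ℝ → ℝ} (h : IsCausal T B β β') :
    HasBoundedPartials T B (fun x t => β (1 * x + t + -1)) (fun x t => 1 * β' (1 * x + t + -1))
      (fun x t => β' (1 * x + t + -1)) where
  toHasPartials := HasPartials.of_comp_linear h.continuous_deriv h.hasDerivAt _ _
  bound x hx t ht := h.bound _ (by linarith [hx.2, ht.2])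
  bound_x x hx t ht := by
    rw [one_mul]
    exact h.bound_deriv _ (by linarith [hx.2, ht.2])
  bound_t x hx t ht := h.bound_deriv _ (by linarith [hx.2, ht.2])

theorem of_mul_linear {B : ℝ} {β β' : ℝ → ℝ} (h : IsCausal T B β β') {m k : ℝ}
    (hm : |m| ≤ 1) (hk : ∀ x ∈ Icc (0 : ℝ) 1, |m * x + k| ≤ 1) :
    HasBoundedPartials T B (fun x t => (m * x + k) * β t) (fun _ t => m * β t)
      (fun x t => (m * x + k) * β' t) where
  toHasPartials := HasPartials.of_mul_linear h.continuous_deriv h.hasDerivAt _ _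
  bound x hx t ht := by
    rw [abs_mul]
    exact (mul_le_of_le_one_left (abs_nonneg _) (hk x hx)).trans (h.bound t ht.2)
  bound_x x hx t ht := by
    rw [abs_mul]
    exact (mul_le_of_le_one_left (abs_nonneg _) hm).trans (h.bound t ht.2)
  bound_t x hx t ht := by
    rw [abs_mul]
    exact (mul_le_of_le_one_left (abs_nonneg _) (hk x hx)).trans (h.bound_deriv t ht.2)

end HasBoundedPartials

/-- A pair `(P, G)` that takes the boundary and the initial values and solves the undamped system up
to a source which is affine in `x` and balances the damping at the two ends. -/
structure IsLift (T K c : ℝ) (γ₀ γ₁ b₀ b₁ : ℝ → ℝ) (P Px Pt G Gx Gt : ℝ → ℝ → ℝ) : Prop where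
  pressure : HasBoundedPartials T K P Px Pt
  flux : HasBoundedPartials T K G Gx Gt
  mass : ∀ x t, Pt x t + Gx x t = 0
  momentum : ∀ x t, Gt x t + Px x t = -((1 - x) * b₀ t + x * b₁ t)
  left : ∀ t ∈ Icc 0 T, G 0 t = γ₀ t
  right : ∀ t ∈ Icc 0 T, G 1 t = γ₁ t
  initial_p : ∀ x ∈ Icc (0 : ℝ) 1, P x 0 = c
  initial_u : ∀ x ∈ Icc (0 : ℝ) 1, G x 0 = 0

/-- The lift is the solution of the wave equation with the fluxes `γᵢ + ∫ a(γᵢ)` at the ends, minus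
the affine interpolation of the integrals `∫ a(γᵢ)`. The time derivative of that interpolation is
the source. The obvious choice, a polynomial in `x`, would have to involve the time derivative of
`a(γᵢ)`, and would then not be of class `C¹`. -/
theorem exists_isLift {T : ℝ} (hT : 0 < T) (a₁ B M : ℝ) :
    ∃ K : ℝ, ∀ (a₂ c : ℝ) (a D γ₀ γ₀' γ₁ γ₁' : ℝ → ℝ), IsRegularDamping a₁ a₂ a D →
      IsCausal T B γ₀ γ₀' → IsCausal T B γ₁ γ₁' → |c| ≤ M →
      ∃ P Px Pt G Gx Gt : ℝ → ℝ → ℝ,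
        IsLift T K c γ₀ γ₁ (fun t => a (γ₀ t)) (fun t => a (γ₁ t)) P Px Pt G Gx Gt := by
  obtain ⟨N, hN⟩ := exists_nat_ge T
  let B₁ : ℝ := a₁ * B * (1 + T)
  let A : ℝ := N * (2 * (B + B₁))
  refine ⟨(M + (A + (A + (B + B₁))) + 1 * B₁ * (1 + T) + 1 * B₁ * (1 + T)) +
    (A + (A + (B + B₁)) + B₁ + B₁), fun a₂ c a D γ₀ γ₀' γ₁ γ₁' ha h₀ h₁ hc => ?_⟩
  have i₀ := h₀.integral_damping hT ha
  have i₁ := h₁.integral_damping hT ha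
  have hid : IsRegularDamping 1 0 id (fun _ => 1) :=
    ⟨continuous_const, fun ξ => hasDerivAt_id ξ, rfl, by simp, by simp, by simp⟩
  obtain ⟨α, α', hα, hr⟩ := (h₀.add i₀).exists_reflection (h₁.add i₁) N
  have hβ := (hα.delay zero_le_one).add (h₁.add i₁).neg
  have hP := (((HasBoundedPartials.const c).mono hc |>.add ((HasBoundedPartials.right_wave hα).add
    (HasBoundedPartials.left_wave hβ))).sub
    (HasBoundedPartials.of_mul_linear (i₀.integral_damping hT hid) (m := 0) (k := 1)
      (by simp) (by simp))).add
    (HasBoundedPartials.of_mul_linear (i₁.integral_damping hT hid) (m := 0) (k := 1)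
      (by simp) (by simp))
  have hG := (((HasBoundedPartials.right_wave hα).sub (HasBoundedPartials.left_wave hβ)).sub
    (HasBoundedPartials.of_mul_linear i₀ (m := -1) (k := 1) (by simp) (fun x hx => by
      rw [abs_le]
      constructor <;> linarith [hx.1, hx.2]))).sub
    (HasBoundedPartials.of_mul_linear i₁ (m := 1) (k := 0) (by simp) (fun x hx => by
      rw [abs_le]
      constructor <;> linarith [hx.1, hx.2]))
  have hA : 0 ≤ A := hα.bound_nonneg
  have hB : 0 ≤ B := h₀.bound_nonneg
  have hB₁ : 0 ≤ B₁ := i₀.bound_nonneg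
  have hM : 0 ≤ M := (abs_nonneg c).trans hc
  have hBT : 0 ≤ 1 * B₁ * (1 + T) := by positivity
  refine ⟨_, _, _, _, _, _, hP.mono (by linarith), hG.mono (by linarith), fun x t => ?_,
    fun x t => ?_, fun t ht => ?_, fun t _ => ?_, fun x hx => ?_, fun x hx => ?_⟩
  · simp only [id]
    ring
  · ring
  · have h3 := hr t (by linarith [ht.2])
    have e1 : -1 * (0 : ℝ) + t + 0 = t := by ring
    have e2 : 1 * (0 : ℝ) + t + -1 = t - 1 := by ring
    have e3 : t - 1 - 1 = t - 2 := by ring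
    simp only [e1, e2, e3, h3]
    ring
  · have e1 : -1 * (1 : ℝ) + t + 0 = t - 1 := by ring
    have e2 : 1 * (1 : ℝ) + t + -1 = t := by ring
    simp only [e1, e2]
    ring
  · have e1 : -1 * x + 0 + 0 ≤ 0 := by linarith [hx.1]
    have e2 : 1 * x + 0 + -1 ≤ 0 := by linarith [hx.2]
    have e3 : 1 * x + 0 + -1 - 1 ≤ 0 := by linarith [hx.2]
    have e4 := i₁.eq_zero _ e2
    simp only [hα.eq_zero _ e1, hα.eq_zero _ e3, h₁.eq_zero _ e2, e4]
    simp
  · have e1 : -1 * x + 0 + 0 ≤ 0 := by linarith [hx.1]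
    have e2 : 1 * x + 0 + -1 ≤ 0 := by linarith [hx.2]
    have e3 : 1 * x + 0 + -1 - 1 ≤ 0 := by linarith [hx.2]
    have e4 := i₁.eq_zero _ e2
    simp only [hα.eq_zero _ e1, hα.eq_zero _ e3, h₁.eq_zero _ e2, e4]
    simp

/-! ### Fixed points in weighted supremum norms -/

section Weighted

variable {X : Type*} [TopologicalSpace X] [CompactSpace X]

/-- A map that halves distances in the supremum norm with weight `1 / ρ` has a fixed point. -/
theorem exists_fixedPoint_of_weight (Φ : C(X, ℝ) → C(X, ℝ)) (ρ : C(X, ℝ)) (hρ : ∀ k, 0 < ρ k)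
    (h : ∀ e e' A, 0 ≤ A → (∀ k, |e k - e' k| ≤ A * ρ k) →
      ∀ k, |Φ e k - Φ e' k| ≤ A / 2 * ρ k) : ∃ e, Φ e = e := by
  let ι : C(X, ℝ) := ⟨fun k => (ρ k)⁻¹, ρ.continuous.inv₀ fun k => (hρ k).ne'⟩
  let Ψ : C(X, ℝ) → C(X, ℝ) := fun e => ι * Φ (ρ * e)
  have hΨ : ContractingWith (1 / 2) Ψ := by
    refine ⟨by norm_num, LipschitzWith.of_dist_le_mul fun e e' => ?_⟩
    rw [ContinuousMap.dist_le (by positivity)]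
    intro k
    have h1 := h (ρ * e) (ρ * e') (dist e e') dist_nonneg (fun k => by
      rw [ContinuousMap.mul_apply, ContinuousMap.mul_apply, ← mul_sub, abs_mul,
        abs_of_pos (hρ k), mul_comm]
      refine mul_le_mul_of_nonneg_right ?_ (hρ k).le
      rw [← Real.dist_eq]
      exact ContinuousMap.dist_apply_le_dist k) k
    simp only [Ψ, ContinuousMap.mul_apply, ι, ContinuousMap.coe_mk, Real.dist_eq]
    rw [← mul_sub, abs_mul, abs_of_pos (inv_pos.2 (hρ k)), inv_mul_le_iff₀ (hρ k)]
    refine h1.trans (le_of_eq ?_)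
    push_cast
    ring
  have : Nonempty C(X, ℝ) := ⟨0⟩
  refine ⟨ρ * ContractingWith.fixedPoint Ψ hΨ, ?_⟩
  have h2 : Ψ (ContractingWith.fixedPoint Ψ hΨ) = _ := hΨ.fixedPoint_isFixedPt
  conv_rhs => rw [← h2]
  ext k
  simp only [Ψ, ContinuousMap.mul_apply, ι, ContinuousMap.coe_mk]
  rw [mul_inv_cancel_left₀ (hρ k).ne']

/-- A bound that improves itself in a weighted supremum norm. -/
theorem abs_le_of_weight (e ρ : C(X, ℝ)) (hρ : ∀ k, 0 < ρ k) {A₀ : ℝ} (hA₀ : 0 ≤ A₀)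
    (h : ∀ A, 0 ≤ A → (∀ k, |e k| ≤ A * ρ k) → ∀ k, |e k| ≤ (A₀ + A / 2) * ρ k) (k : X) :
    |e k| ≤ 2 * A₀ * ρ k := by
  let q : C(X, ℝ) := ⟨fun k => e k / ρ k, e.continuous.div₀ ρ.continuous fun k => (hρ k).ne'⟩
  have hq : ∀ A k, |q k| ≤ A ↔ |e k| ≤ A * ρ k := fun A k => by
    simp only [q, ContinuousMap.coe_mk]
    rw [abs_div, abs_of_pos (hρ k), div_le_iff₀ (hρ k)]
  have h1 : ∀ k, |e k| ≤ ‖q‖ * ρ k := fun k => (hq _ k).1 (q.norm_coe_le_norm k)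
  have h2 : ‖q‖ ≤ A₀ + ‖q‖ / 2 :=
    (ContinuousMap.norm_le _ (by positivity)).2 fun k => (hq _ k).2 (h _ (norm_nonneg q) h1 k)
  refine (h1 k).trans (mul_le_mul_of_nonneg_right ?_ (hρ k).le)
  linarith

end Weighted

/-! ### The integral equation for the space derivative of the flux -/

/-- The distance to the nearest even integer: the even `2`-periodic map that folds the line to the
unit interval. -/
noncomputable def fold (x : ℝ) : ℝ := Real.arccos (Real.cos (Real.pi * x)) / Real.pi

theorem continuous_fold : Continuous fold := by
  unfold fold
  have := Real.continuous_arccos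
  have := Real.continuous_cos
  fun_prop

theorem fold_mem (x : ℝ) : fold x ∈ Icc (0 : ℝ) 1 :=
  ⟨div_nonneg (Real.arccos_nonneg _) Real.pi_pos.le,
    (div_le_one Real.pi_pos).2 (Real.arccos_le_pi _)⟩

theorem fold_of_mem {x : ℝ} (hx : x ∈ Icc (0 : ℝ) 1) : fold x = x := by
  have hp := Real.pi_pos
  rw [fold, Real.arccos_cos (mul_nonneg hp.le hx.1) (mul_le_of_le_one_right hp.le hx.2),
    mul_div_cancel_left₀ _ hp.ne']

theorem fold_neg (x : ℝ) : fold (-x) = fold x := by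
  rw [fold, fold, mul_neg, Real.cos_neg]

theorem fold_add_two (x : ℝ) : fold (x + 2) = fold x := by
  have : Real.pi * (x + 2) = Real.pi * x + 2 * Real.pi := by ring
  rw [fold, fold, this, Real.cos_add_two_pi]

/-- The mean value over the unit interval. -/
noncomputable def mean (e : ℝ → ℝ → ℝ) (t : ℝ) : ℝ := ∫ y in (0 : ℝ)..1, e y t

/-- The primitive, with zero boundary values, of a function of `x` with its mean value removed. -/
noncomputable def primitive (e : ℝ → ℝ → ℝ) (x t : ℝ) : ℝ :=
  ∫ y in (0 : ℝ)..x, (e y t - mean e t)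

/-- The space derivative of `a (G + v) - (1 - x) b₀ - x b₁`, where `v` has the derivative `e` (up to
its mean value), which is truncated at height `R`. -/
noncomputable def sourceSlope (D : ℝ → ℝ) (G Gx : ℝ → ℝ → ℝ) (b₀ b₁ : ℝ → ℝ) (R : ℝ)
    (e : ℝ → ℝ → ℝ) (x t : ℝ) : ℝ :=
  D (G x t + primitive e x t) * (Gx x t + max (-R) (min R (e x t - mean e t))) + b₀ t - b₁ t

/-- The space derivative of the flux in the wave equation on the unit interval with zero initial
and boundary values and with a momentum source whose space derivative is `-φ`. -/
noncomputable def propagate (φ : ℝ → ℝ → ℝ) (x t : ℝ) : ℝ :=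
  -(1 / 2) * ∫ s in (0 : ℝ)..t, (φ (fold (x - t + s)) s + φ (fold (x + t - s)) s)

section Continuity

variable {e : ℝ → ℝ → ℝ}

theorem continuous_mean (he : Continuous fun z : ℝ × ℝ => e z.1 z.2) : Continuous (mean e) :=
  continuous_integral_of_continuous
    (he.comp (by fun_prop : Continuous fun z : ℝ × ℝ => (z.2, z.1))) continuous_const
    continuous_const

theorem continuous_primitive (he : Continuous fun z : ℝ × ℝ => e z.1 z.2) :
    Continuous fun z : ℝ × ℝ => primitive e z.1 z.2 :=
  continuous_integral_of_continuous (h := fun (z : ℝ × ℝ) y => e y z.2 - mean e z.2)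
    ((he.comp (by fun_prop : Continuous fun z : (ℝ × ℝ) × ℝ => (z.2, z.1.2))).sub
      ((continuous_mean he).comp (by fun_prop)))
    continuous_const continuous_fst

theorem continuous_sourceSlope (he : Continuous fun z : ℝ × ℝ => e z.1 z.2) {D : ℝ → ℝ}
    {G Gx : ℝ → ℝ → ℝ} {b₀ b₁ : ℝ → ℝ} (hD : Continuous D)
    (hG : Continuous fun z : ℝ × ℝ => G z.1 z.2) (hGx : Continuous fun z : ℝ × ℝ => Gx z.1 z.2)
    (h₀ : Continuous b₀) (h₁ : Continuous b₁) (R : ℝ) :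
    Continuous fun z : ℝ × ℝ => sourceSlope D G Gx b₀ b₁ R e z.1 z.2 := by
  have h1 := continuous_mean he
  have h2 := continuous_primitive he
  unfold sourceSlope
  fun_prop

theorem continuous_propagate (he : Continuous fun z : ℝ × ℝ => e z.1 z.2) :
    Continuous fun z : ℝ × ℝ => propagate e z.1 z.2 := by
  have hf := continuous_fold
  refine continuous_const.mul (continuous_integral_of_continuous
    (h := fun (z : ℝ × ℝ) s => e (fold (z.1 - z.2 + s)) s + e (fold (z.1 + z.2 - s)) s)
    (Continuous.add ?_ ?_) continuous_const continuous_snd)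
  · exact he.comp (by fun_prop : Continuous fun z : (ℝ × ℝ) × ℝ =>
      (fold (z.1.1 - z.1.2 + z.2), z.2))
  · exact he.comp (by fun_prop : Continuous fun z : (ℝ × ℝ) × ℝ =>
      (fold (z.1.1 + z.1.2 - z.2), z.2))

end Continuity

section Estimates

variable {e e' : ℝ → ℝ → ℝ} {t E : ℝ}

theorem abs_mean_sub_le (he : Continuous fun z : ℝ × ℝ => e z.1 z.2)
    (he' : Continuous fun z : ℝ × ℝ => e' z.1 z.2)
    (h : ∀ x ∈ Icc (0 : ℝ) 1, |e x t - e' x t| ≤ E) : |mean e t - mean e' t| ≤ E := by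
  have c1 : Continuous fun y => e y t := he.comp (by fun_prop : Continuous fun y : ℝ => (y, t))
  have c2 : Continuous fun y => e' y t := he'.comp (by fun_prop : Continuous fun y : ℝ => (y, t))
  rw [mean, mean, ← intervalIntegral.integral_sub (c1.intervalIntegrable _ _)
    (c2.intervalIntegrable _ _)]
  have := intervalIntegral.norm_integral_le_of_norm_le_const (f := fun y => e y t - e' y t)
    (a := 0) (b := 1) (C := E) fun y hy => h y (by
      rw [uIoc_of_le zero_le_one] at hy
      exact ⟨hy.1.le, hy.2⟩)
  simpa using this

theorem abs_primitive_sub_le (he : Continuous fun z : ℝ × ℝ => e z.1 z.2)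
    (he' : Continuous fun z : ℝ × ℝ => e' z.1 z.2)
    (h : ∀ x ∈ Icc (0 : ℝ) 1, |e x t - e' x t| ≤ E) {x : ℝ} (hx : x ∈ Icc (0 : ℝ) 1) :
    |primitive e x t - primitive e' x t| ≤ 2 * E := by
  have c1 : Continuous fun y => e y t := he.comp (by fun_prop : Continuous fun y : ℝ => (y, t))
  have c2 : Continuous fun y => e' y t := he'.comp (by fun_prop : Continuous fun y : ℝ => (y, t))
  have hm := abs_mean_sub_le he he' h
  rw [primitive, primitive, ← intervalIntegral.integral_sub
    ((by fun_prop : Continuous fun y => e y t - mean e t).intervalIntegrable _ _)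
    ((by fun_prop : Continuous fun y => e' y t - mean e' t).intervalIntegrable _ _)]
  have := intervalIntegral.norm_integral_le_of_norm_le_const
    (f := fun y => e y t - mean e t - (e' y t - mean e' t))
    (a := 0) (b := x) (C := 2 * E) fun y hy => by
      rw [uIoc_of_le hx.1] at hy
      have h1 := h y ⟨hy.1.le, hy.2.trans hx.2⟩
      rw [Real.norm_eq_abs, sub_sub_sub_comm]
      exact (abs_sub _ _).trans (by linarith)
  rw [Real.norm_eq_abs, sub_zero, abs_of_nonneg hx.1] at this
  have hE : 0 ≤ E := (abs_nonneg _).trans hm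
  nlinarith [hx.2]

variable {a₁ a₂ K R : ℝ} {a D b₀ b₁ : ℝ → ℝ} {G Gx : ℝ → ℝ → ℝ} {x : ℝ}

theorem abs_clamp_le {R y K : ℝ} (hR : 0 ≤ R) (hy : |y| ≤ K) : |max (-R) (min R y)| ≤ K := by
  rw [abs_le] at hy ⊢
  have : 0 ≤ K := by linarith
  constructor
  · rcases le_total (-R) y with h | h
    · exact (le_min (by linarith) hy.1).trans (le_max_right _ _)
    · exact (hy.1.trans h).trans (le_max_left _ _)
  · exact max_le (by linarith) ((min_le_right _ _).trans hy.2)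

theorem abs_clamp_le' {R y : ℝ} (hR : 0 ≤ R) : |max (-R) (min R y)| ≤ R := by
  rw [abs_le]
  exact ⟨le_max_left _ _, max_le (by linarith) (min_le_left _ _)⟩

theorem abs_clamp_sub_le (R y z : ℝ) :
    |max (-R) (min R y) - max (-R) (min R z)| ≤ |y - z| := by
  have h1 := abs_max_sub_max_le_abs (min R y) (min R z) (-R)
  have h2 := abs_min_sub_min_le_max R y R z
  rw [sub_self, abs_zero, max_eq_right (abs_nonneg _)] at h2
  rw [max_comm, max_comm (-R)]
  exact h1.trans h2

/-- Lipschitz estimate for the truncated source. -/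
theorem abs_sourceSlope_sub_le (ha : IsRegularDamping a₁ a₂ a D) (ha₂ : 0 ≤ a₂)
    (he : Continuous fun z : ℝ × ℝ => e z.1 z.2)
    (he' : Continuous fun z : ℝ × ℝ => e' z.1 z.2) (hR : 0 ≤ R) (hGx : |Gx x t| ≤ K)
    (h : ∀ x ∈ Icc (0 : ℝ) 1, |e x t - e' x t| ≤ E) (hx : x ∈ Icc (0 : ℝ) 1) :
    |sourceSlope D G Gx b₀ b₁ R e x t - sourceSlope D G Gx b₀ b₁ R e' x t|
      ≤ 2 * (a₂ * (K + R) + a₁) * E := by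
  have hm := abs_mean_sub_le he he' h
  have hv := abs_primitive_sub_le he he' h hx
  set m := mean e t
  set m' := mean e' t
  set v := primitive e x t
  set v' := primitive e' x t
  set ε := max (-R) (min R (e x t - m)) with hε
  set ε' := max (-R) (min R (e' x t - m'))
  have e1 : sourceSlope D G Gx b₀ b₁ R e x t - sourceSlope D G Gx b₀ b₁ R e' x t
      = (D (G x t + v) - D (G x t + v')) * (Gx x t + ε) + D (G x t + v') * (ε - ε') := by
    simp only [sourceSlope]
    ring
  have h1 : |D (G x t + v) - D (G x t + v')| ≤ a₂ * (2 * E) :=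
    (ha.lipschitz_deriv _ _).trans (mul_le_mul_of_nonneg_left (by simpa using hv) ha₂)
  have h2 : |Gx x t + ε| ≤ K + R := (abs_add_le _ _).trans (add_le_add hGx (abs_clamp_le' hR))
  have h3 : |ε - ε'| ≤ 2 * E := by
    refine (abs_clamp_sub_le R _ _).trans ?_
    rw [sub_sub_sub_comm]
    exact (abs_sub _ _).trans (by linarith [h x hx])
  have hE : 0 ≤ E := (abs_nonneg _).trans hm
  rw [e1]
  refine (abs_add_le _ _).trans ?_
  rw [abs_mul, abs_mul]
  have h4 := mul_le_mul h1 h2 (abs_nonneg _) (by positivity)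
  have h5 := mul_le_mul (ha.abs_deriv_le (G x t + v')) h3 (abs_nonneg _)
    ((abs_nonneg _).trans (ha.abs_deriv_le 0))
  linarith

theorem mean_zero (t : ℝ) : mean (fun _ _ => 0) t = 0 := by simp [mean]

theorem abs_sub_mean_le (he : Continuous fun z : ℝ × ℝ => e z.1 z.2)
    (h : ∀ x ∈ Icc (0 : ℝ) 1, |e x t| ≤ E) (hx : x ∈ Icc (0 : ℝ) 1) :
    |e x t - mean e t| ≤ 2 * E := by
  have hm := abs_mean_sub_le (e' := fun _ _ => 0) he continuous_const (by simpa using h)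
  rw [mean_zero, sub_zero] at hm
  exact (abs_sub _ _).trans (by linarith [h x hx])

/-- Linear growth of the truncated source, independent of the truncation. -/
theorem abs_sourceSlope_le (ha : IsRegularDamping a₁ a₂ a D)
    (he : Continuous fun z : ℝ × ℝ => e z.1 z.2) (hR : 0 ≤ R) (hGx : |Gx x t| ≤ K)
    (h₀ : |b₀ t| ≤ K) (h₁ : |b₁ t| ≤ K)
    (h : ∀ x ∈ Icc (0 : ℝ) 1, |e x t| ≤ E) (hx : x ∈ Icc (0 : ℝ) 1) :
    |sourceSlope D G Gx b₀ b₁ R e x t| ≤ a₁ * (K + 2 * E) + 2 * K := by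
  have h1 := abs_clamp_le hR (abs_sub_mean_le he h hx)
  have h2 : |Gx x t + max (-R) (min R (e x t - mean e t))| ≤ K + 2 * E :=
    (abs_add_le _ _).trans (add_le_add hGx h1)
  have h3 := mul_le_mul (ha.abs_deriv_le (G x t + primitive e x t)) h2 (abs_nonneg _)
    ((abs_nonneg _).trans (ha.abs_deriv_le 0))
  rw [← abs_mul] at h3
  refine (abs_sub _ _).trans ?_
  have := abs_add_le (D (G x t + primitive e x t) *
    (Gx x t + max (-R) (min R (e x t - mean e t)))) (b₀ t)
  linarith

theorem abs_propagate_sub_le {φ φ' : ℝ → ℝ → ℝ} (hφ : Continuous fun z : ℝ × ℝ => φ z.1 z.2)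
    (hφ' : Continuous fun z : ℝ × ℝ => φ' z.1 z.2) {c κ : ℝ} (hc : 0 ≤ c) (hκ : 0 < κ)
    (ht : 0 ≤ t) (h : ∀ x ∈ Icc (0 : ℝ) 1, ∀ s ∈ Icc 0 t, |φ x s - φ' x s| ≤ c * Real.exp (κ * s))
    (x : ℝ) : |propagate φ x t - propagate φ' x t| ≤ c / κ * Real.exp (κ * t) := by
  have hf := continuous_fold
  have hc1 : ∀ {ψ : ℝ → ℝ → ℝ}, (Continuous fun z : ℝ × ℝ => ψ z.1 z.2) →
      Continuous fun s => ψ (fold (x - t + s)) s + ψ (fold (x + t - s)) s := fun hψ =>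
    (hψ.comp (by fun_prop : Continuous fun s : ℝ => (fold (x - t + s), s))).add
      (hψ.comp (by fun_prop : Continuous fun s : ℝ => (fold (x + t - s), s)))
  rw [propagate, propagate, ← mul_sub, ← intervalIntegral.integral_sub
    ((hc1 hφ).intervalIntegrable _ _) ((hc1 hφ').intervalIntegrable _ _), abs_mul]
  have h1 : ∀ s ∈ Ioc 0 t, ‖φ (fold (x - t + s)) s + φ (fold (x + t - s)) s
      - (φ' (fold (x - t + s)) s + φ' (fold (x + t - s)) s)‖ ≤ 2 * c * Real.exp (κ * s) := by
    intro s hs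
    rw [add_sub_add_comm]
    refine (abs_add_le _ _).trans ?_
    have h2 := h _ (fold_mem (x - t + s)) s ⟨hs.1.le, hs.2⟩
    have h3 := h _ (fold_mem (x + t - s)) s ⟨hs.1.le, hs.2⟩
    linarith
  have h4 := intervalIntegral.norm_integral_le_of_norm_le (μ := volume) ht (Eventually.of_forall h1)
    ((by fun_prop : Continuous fun s => 2 * c * Real.exp (κ * s)).intervalIntegrable _ _)
  have h5 : ∫ s in (0 : ℝ)..t, 2 * c * Real.exp (κ * s)
      = 2 * (c / κ * (Real.exp (κ * t) - 1)) := by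
    rw [intervalIntegral.integral_const_mul, intervalIntegral.integral_comp_mul_left _ hκ.ne',
      integral_exp, mul_zero, Real.exp_zero, smul_eq_mul]
    field_simp
  rw [h5, Real.norm_eq_abs] at h4
  have h6 : |(-(1 / 2) : ℝ)| = 1 / 2 := by norm_num
  have h7 : 0 ≤ c / κ := div_nonneg hc hκ.le
  rw [h6]
  linarith

end Estimates

/-- The extension of a function on `[0,1] × [0,T]` to the plane that is constant in the normal
directions. -/
noncomputable def extend {T : ℝ} (hT : 0 ≤ T) (e : C(Icc (0 : ℝ) 1 × Icc (0 : ℝ) T, ℝ)) (x t : ℝ) :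
    ℝ :=
  e (projIcc 0 1 zero_le_one x, projIcc 0 T hT t)

section Extend

variable {T : ℝ} (hT : 0 ≤ T) (e : C(Icc (0 : ℝ) 1 × Icc (0 : ℝ) T, ℝ))

theorem continuous_extend : Continuous fun z : ℝ × ℝ => extend hT e z.1 z.2 :=
  e.continuous.comp ((continuous_projIcc.comp continuous_fst).prodMk
    (continuous_projIcc.comp continuous_snd))

theorem extend_of_mem {x t : ℝ} (hx : x ∈ Icc (0 : ℝ) 1) (ht : t ∈ Icc 0 T) :
    extend hT e x t = e (⟨x, hx⟩, ⟨t, ht⟩) := by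
  simp only [extend, projIcc_of_mem _ hx, projIcc_of_mem _ ht]

/-- The exponential weight. -/
noncomputable def expWeight (T κ : ℝ) : C(Icc (0 : ℝ) 1 × Icc (0 : ℝ) T, ℝ) :=
  ⟨fun k => Real.exp (κ * k.2), by fun_prop⟩

theorem expWeight_pos (T κ : ℝ) (k : Icc (0 : ℝ) 1 × Icc (0 : ℝ) T) : 0 < expWeight T κ k :=
  Real.exp_pos _

variable {a₁ a₂ K R : ℝ} {a D b₀ b₁ : ℝ → ℝ} {G Gx : ℝ → ℝ → ℝ}

/-- The integral equation with a truncated source, solved by contraction in the supremum norm with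
weight `exp (-κ t)`. -/
theorem exists_truncated_slope (ha : IsRegularDamping a₁ a₂ a D) (ha₁ : 0 ≤ a₁) (ha₂ : 0 ≤ a₂)
    (hK : 0 ≤ K) (hR : 0 ≤ R)
    (hG : Continuous fun z : ℝ × ℝ => G z.1 z.2) (hGx : Continuous fun z : ℝ × ℝ => Gx z.1 z.2)
    (hb₀ : Continuous b₀) (hb₁ : Continuous b₁)
    (hGxK : ∀ x ∈ Icc (0 : ℝ) 1, ∀ t ∈ Icc 0 T, |Gx x t| ≤ K) :
    ∃ e : C(Icc (0 : ℝ) 1 × Icc (0 : ℝ) T, ℝ), ∀ k,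
      e k = propagate (sourceSlope D G Gx b₀ b₁ R (extend hT e)) k.1 k.2 := by
  obtain ⟨L, hL'⟩ : ∃ L, L = 2 * (a₂ * (K + R) + a₁) := ⟨_, rfl⟩
  have hL : 0 ≤ L := by rw [hL']; positivity
  have hκ : 0 < 2 * L + 1 := by positivity
  have hS : ∀ e, Continuous fun z : ℝ × ℝ =>
      sourceSlope D G Gx b₀ b₁ R (extend hT e) z.1 z.2 := fun e =>
    continuous_sourceSlope (continuous_extend hT e) ha.continuous_deriv hG hGx hb₀ hb₁ R
  have hP : ∀ e : C(Icc (0 : ℝ) 1 × Icc (0 : ℝ) T, ℝ),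
      Continuous fun k : Icc (0 : ℝ) 1 × Icc (0 : ℝ) T =>
        propagate (sourceSlope D G Gx b₀ b₁ R (extend hT e)) k.1 k.2 := fun e =>
    Continuous.comp (g := fun z : ℝ × ℝ =>
      propagate (sourceSlope D G Gx b₀ b₁ R (extend hT e)) z.1 z.2)
      (f := fun k : Icc (0 : ℝ) 1 × Icc (0 : ℝ) T => ((k.1 : ℝ), (k.2 : ℝ)))
      (continuous_propagate (hS e)) ((continuous_subtype_val.comp continuous_fst).prodMk
      (continuous_subtype_val.comp continuous_snd))
  obtain ⟨Φ, hΦ⟩ : ∃ Φ : C(Icc (0 : ℝ) 1 × Icc (0 : ℝ) T, ℝ) → C(Icc (0 : ℝ) 1 × Icc (0 : ℝ) T, ℝ),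
      ∀ e k, Φ e k = propagate (sourceSlope D G Gx b₀ b₁ R (extend hT e)) k.1 k.2 :=
    ⟨fun e => ⟨_, hP e⟩, fun _ _ => rfl⟩
  obtain ⟨e, he⟩ := exists_fixedPoint_of_weight Φ (expWeight T (2 * L + 1))
    (expWeight_pos T (2 * L + 1)) (by
      intro e e' A hA h k
      have h1 := abs_propagate_sub_le (hS e) (hS e') (c := L * A) (mul_nonneg hL hA) hκ
        k.2.2.1 (fun x hx s hs => by
          have hs' : s ∈ Icc 0 T := ⟨hs.1, hs.2.trans k.2.2.2⟩
          have := abs_sourceSlope_sub_le (G := G) (b₀ := b₀) (b₁ := b₁)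
            (E := A * Real.exp ((2 * L + 1) * s)) ha ha₂ (continuous_extend hT e)
            (continuous_extend hT e') hR (hGxK x hx s hs') (fun y hy => by
              rw [extend_of_mem hT e hy hs', extend_of_mem hT e' hy hs']
              exact h _) hx
          rw [mul_assoc, hL']
          rw [hL'] at this
          exact this) k.1
      rw [hΦ, hΦ]
      refine h1.trans (mul_le_mul_of_nonneg_right ?_ (Real.exp_pos _).le)
      rw [div_le_iff₀ hκ]
      nlinarith)
  exact ⟨e, fun k => by rw [← hΦ, he]⟩

/-- The linear growth of the source gives a bound that does not depend on the truncation. -/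
theorem abs_truncated_slope_le (ha : IsRegularDamping a₁ a₂ a D) (ha₁ : 0 ≤ a₁)
    (hK : 0 ≤ K) (hR : 0 ≤ R)
    (hG : Continuous fun z : ℝ × ℝ => G z.1 z.2) (hGx : Continuous fun z : ℝ × ℝ => Gx z.1 z.2)
    (hb₀ : Continuous b₀) (hb₁ : Continuous b₁)
    (hGxK : ∀ x ∈ Icc (0 : ℝ) 1, ∀ t ∈ Icc 0 T, |Gx x t| ≤ K)
    (hb₀K : ∀ t ∈ Icc 0 T, |b₀ t| ≤ K) (hb₁K : ∀ t ∈ Icc 0 T, |b₁ t| ≤ K)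
    (he : ∀ k, e k = propagate (sourceSlope D G Gx b₀ b₁ R (extend hT e)) k.1 k.2)
    (k : Icc (0 : ℝ) 1 × Icc (0 : ℝ) T) :
    |e k| ≤ 2 * (a₁ * K + 2 * K) * Real.exp ((4 * a₁ + 1) * T) := by
  have hκ : 0 < 4 * a₁ + 1 := by positivity
  have hA₀ : 0 ≤ a₁ * K + 2 * K := by positivity
  have hS : Continuous fun z : ℝ × ℝ => sourceSlope D G Gx b₀ b₁ R (extend hT e) z.1 z.2 :=
    continuous_sourceSlope (continuous_extend hT e) ha.continuous_deriv hG hGx hb₀ hb₁ R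
  refine (abs_le_of_weight e (expWeight T (4 * a₁ + 1)) (expWeight_pos T _) hA₀ ?_ k).trans
    (mul_le_mul_of_nonneg_left
      (Real.exp_le_exp.2 (mul_le_mul_of_nonneg_left k.2.2.2 hκ.le)) (by positivity))
  intro A hA h k
  have h2 := abs_propagate_sub_le (φ' := fun _ _ => 0) hS continuous_const
    (c := a₁ * K + 2 * K + 2 * a₁ * A) (by positivity) hκ k.2.2.1 (fun x hx s hs => by
      have hs' : s ∈ Icc 0 T := ⟨hs.1, hs.2.trans k.2.2.2⟩
      have := abs_sourceSlope_le (G := G) (b₀ := b₀) (b₁ := b₁)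
        (E := A * Real.exp ((4 * a₁ + 1) * s)) ha (continuous_extend hT e) hR (hGxK x hx s hs')
        (hb₀K s hs') (hb₁K s hs') (fun y hy => by
          rw [extend_of_mem hT e hy hs']
          exact h _) hx
      rw [sub_zero]
      have h3 : 1 ≤ Real.exp ((4 * a₁ + 1) * s) := Real.one_le_exp (mul_nonneg hκ.le hs.1)
      refine this.trans ?_
      have h4 := mul_le_mul_of_nonneg_left h3 hA₀
      linarith) k.1
  have h0 : propagate (fun _ _ => 0) k.1 k.2 = 0 := by simp [propagate]
  rw [h0, sub_zero, ← he k] at h2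
  refine h2.trans (mul_le_mul_of_nonneg_right ?_ (Real.exp_pos _).le)
  rw [div_le_iff₀ hκ]
  nlinarith [mul_nonneg ha₁ hA, mul_nonneg ha₁ hA₀]

end Extend

/-- The integral equation for `e = ∂ₓv`. A truncation of the source that is higher than the bound
for the solution is inactive. -/
theorem exists_slope {T : ℝ} (hT : 0 < T) {K : ℝ} (hK : 0 ≤ K) {a₁ a₂ : ℝ} (ha₁ : 0 ≤ a₁)
    (ha₂ : 0 ≤ a₂) :
    ∃ C : ℝ, 0 ≤ C ∧ ∀ (a D b₀ b₁ : ℝ → ℝ) (G Gx : ℝ → ℝ → ℝ), IsRegularDamping a₁ a₂ a D →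
      (Continuous fun z : ℝ × ℝ => G z.1 z.2) → (Continuous fun z : ℝ × ℝ => Gx z.1 z.2) →
      Continuous b₀ → Continuous b₁ → (∀ x ∈ Icc (0 : ℝ) 1, ∀ t ∈ Icc 0 T, |Gx x t| ≤ K) →
      (∀ t ∈ Icc 0 T, |b₀ t| ≤ K) → (∀ t ∈ Icc 0 T, |b₁ t| ≤ K) →
      ∃ e : ℝ → ℝ → ℝ, (Continuous fun z : ℝ × ℝ => e z.1 z.2) ∧ (∀ x t, |e x t| ≤ C) ∧
        ∀ x ∈ Icc (0 : ℝ) 1, ∀ t ∈ Icc 0 T, e x t = propagate (fun x t =>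
          D (G x t + primitive e x t) * (Gx x t + (e x t - mean e t)) + b₀ t - b₁ t) x t := by
  obtain ⟨C, hC'⟩ : ∃ C, C = 2 * (a₁ * K + 2 * K) * Real.exp ((4 * a₁ + 1) * T) := ⟨_, rfl⟩
  have hC : 0 ≤ C := by rw [hC']; positivity
  have hR : 0 ≤ 2 * C := by positivity
  refine ⟨C, hC, fun a D b₀ b₁ G Gx ha hG hGx hb₀ hb₁ hGxK hb₀K hb₁K => ?_⟩
  obtain ⟨e, he⟩ := exists_truncated_slope hT.le ha ha₁ ha₂ hK hR hG hGx hb₀ hb₁ hGxK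
  have hbd : ∀ k, |e k| ≤ C := by
    rw [hC']
    exact abs_truncated_slope_le hT.le e ha ha₁ hK hR hG hGx hb₀ hb₁ hGxK hb₀K hb₁K he
  have hslope : sourceSlope D G Gx b₀ b₁ (2 * C) (extend hT.le e) = fun x t =>
      D (G x t + primitive (extend hT.le e) x t)
        * (Gx x t + (extend hT.le e x t - mean (extend hT.le e) t)) + b₀ t - b₁ t := by
    funext x t
    have hm := abs_mean_sub_le (t := t) (e' := fun _ _ => 0) (continuous_extend hT.le e)
      continuous_const (E := C) (fun y _ => by
        rw [sub_zero]
        exact hbd _)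
    rw [mean_zero, sub_zero] at hm
    have h1 : |extend hT.le e x t - mean (extend hT.le e) t| ≤ 2 * C := by
      refine (abs_sub _ _).trans ?_
      have : |extend hT.le e x t| ≤ C := hbd _
      linarith
    rw [abs_le] at h1
    rw [sourceSlope, min_eq_right h1.2, max_eq_right h1.1]
  refine ⟨extend hT.le e, continuous_extend hT.le e, fun x t => hbd _, fun x hx t ht => ?_⟩
  rw [extend_of_mem hT.le e hx ht, he, hslope]

/-! ### The wave equation with zero boundary values -/

/-- The solution of the wave equation with zero initial values whose momentum source is the odd
primitive of `-ψ`, obtained as the odd and even parts of a single wave that travels to the right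
on the line. -/
theorem exists_wave_of_source {T B : ℝ} (hT : 0 < T) (hB : 0 ≤ B) {ψ : ℝ → ℝ → ℝ}
    (hψ : Continuous fun z : ℝ × ℝ => ψ z.1 z.2) (heven : ∀ y s, ψ (-y) s = ψ y s)
    (hper : ∀ y s, ψ (y + 2) s = ψ y s) (hb : ∀ y, ∀ s ∈ Icc 0 T, |ψ y s| ≤ B) :
    ∃ v vx vt q qx qt : ℝ → ℝ → ℝ, HasBoundedPartials T (B * (1 + T) ^ 2) v vx vt ∧
      HasBoundedPartials T (B * (1 + T) ^ 2) q qx qt ∧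
      (∀ x t, qt x t + vx x t = 0) ∧ (∀ x t, vt x t + qx x t = -∫ y in (0 : ℝ)..x, ψ y t) ∧
      (∀ x t, vx x t = -(1 / 2) * ∫ s in (0 : ℝ)..t, (ψ (x - t + s) s + ψ (x + t - s) s)) ∧
      (∀ t, v 0 t = 0) ∧ (∀ x, v x 0 = 0) ∧ (∀ x, q x 0 = 0) ∧
      ∀ t, 0 ≤ t → (∀ s ∈ Icc 0 t, ∫ y in (0 : ℝ)..1, ψ y s = 0) → v 1 t = 0 := by
  have hψ1 : ∀ s, Continuous fun y => ψ y s := fun s =>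
    hψ.comp (by fun_prop : Continuous fun y : ℝ => (y, s))
  set n : ℝ → ℝ → ℝ := fun x t => ∫ y in (0 : ℝ)..x, ψ y t with hn
  have hodd : ∀ x t, n (-x) t = -n x t := fun x t => by
    have := intervalIntegral.integral_comp_neg (fun y => ψ y t) (a := 0) (b := x)
    simp only [heven, neg_zero] at this
    simp only [hn]
    rw [this, ← intervalIntegral.integral_symm]
  have hnb : ∀ x, ∀ t ∈ Icc 0 T, |n x t| ≤ B * |x| := fun x t ht => by
    have := intervalIntegral.norm_integral_le_of_norm_le_const (f := fun y => ψ y t)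
      (a := 0) (b := x) (C := B) fun y _ => hb y t ht
    simpa using this
  set w : ℝ → ℝ → ℝ := fun x t => -∫ s in (0 : ℝ)..t, n (x - t + s) s with hw
  set wx : ℝ → ℝ → ℝ := fun x t => -∫ s in (0 : ℝ)..t, ψ (x - t + s) s with hwx
  set wt : ℝ → ℝ → ℝ := fun x t => (∫ s in (0 : ℝ)..t, ψ (x - t + s) s) - n x t with hwt
  have hW : HasPartials w wx wt := hasPartials_duhamel hψ
  have hsub : ∀ {t s : ℝ}, t ∈ Icc 0 T → s ∈ uIoc 0 t → s ∈ Icc 0 t ∧ s ∈ Icc 0 T := by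
    intro t s ht hs
    rw [uIoc_of_le ht.1] at hs
    exact ⟨⟨hs.1.le, hs.2⟩, ⟨hs.1.le, hs.2.trans ht.2⟩⟩
  have hwxb : ∀ x, ∀ t ∈ Icc 0 T, |wx x t| ≤ B * T := fun x t ht => by
    have := intervalIntegral.norm_integral_le_of_norm_le_const
      (f := fun s => ψ (x - t + s) s) (a := 0) (b := t) (C := B) fun s hs =>
        hb _ s (hsub ht hs).2
    rw [sub_zero, abs_of_nonneg ht.1, Real.norm_eq_abs] at this
    simp only [hwx, abs_neg]
    exact this.trans (mul_le_mul_of_nonneg_left ht.2 hB)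
  have hwtb : ∀ x ∈ Icc (-1 : ℝ) 1, ∀ t ∈ Icc 0 T, |wt x t| ≤ B * T + B := fun x hx t ht => by
    have h1 := hwxb x t ht
    simp only [hwx, abs_neg] at h1
    refine (abs_sub _ _).trans (add_le_add h1 ((hnb x t ht).trans ?_))
    exact mul_le_of_le_one_right hB (abs_le.2 hx)
  have hwb : ∀ x ∈ Icc (-1 : ℝ) 1, ∀ t ∈ Icc 0 T, |w x t| ≤ B * (1 + T) * T := fun x hx t ht => by
    have := intervalIntegral.norm_integral_le_of_norm_le_const
      (f := fun s => n (x - t + s) s) (a := 0) (b := t) (C := B * (1 + T)) fun s hs => by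
        obtain ⟨h1, h2⟩ := hsub ht hs
        refine (hnb _ s h2).trans (mul_le_mul_of_nonneg_left ?_ hB)
        rw [abs_le]
        constructor <;> linarith [h1.1, h1.2, ht.1, ht.2, hx.1, hx.2]
    rw [sub_zero, abs_of_nonneg ht.1, Real.norm_eq_abs] at this
    simp only [hw, abs_neg]
    exact this.trans (mul_le_mul_of_nonneg_left ht.2 (by positivity))
  have hc1 : B * T ≤ B * (1 + T) ^ 2 := mul_le_mul_of_nonneg_left (by nlinarith) hB
  have hc2 : B * T + B ≤ B * (1 + T) ^ 2 := by
    nlinarith [mul_nonneg hB hT.le, mul_nonneg hB (sq_nonneg T)]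
  have hc3 : B * (1 + T) * T ≤ B * (1 + T) ^ 2 := by nlinarith [mul_nonneg hB hT.le]
  have hmem : ∀ x ∈ Icc (0 : ℝ) 1, x ∈ Icc (-1 : ℝ) 1 ∧ -x ∈ Icc (-1 : ℝ) 1 := fun x hx =>
    ⟨⟨by linarith [hx.1], hx.2⟩, ⟨by linarith [hx.2], by linarith [hx.1]⟩⟩
  have hhalf : ∀ {y z c : ℝ}, |y| ≤ c → |z| ≤ c →
      |1 / 2 * (y - z)| ≤ c ∧ |1 / 2 * (y + z)| ≤ c := by
    intro y z c hy hz
    rw [abs_le] at hy hz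
    constructor <;> rw [abs_le] <;> constructor <;> linarith [hy.1, hy.2, hz.1, hz.2]
  refine ⟨_, _, _, _, _, _, ⟨(hW.sub hW.reflect).const_mul (1 / 2), ?_, ?_, ?_⟩,
    ⟨(hW.add hW.reflect).const_mul (1 / 2), ?_, ?_, ?_⟩, fun x t => ?_, fun x t => ?_,
    fun x t => ?_, fun t => by simp, fun x => by simp [hw], fun x => by simp [hw],
    fun t ht h => ?_⟩
  · exact fun x hx t ht => (hhalf (hwb x (hmem x hx).1 t ht) (hwb _ (hmem x hx).2 t ht)).1.trans hc3
  · intro x hx t ht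
    rw [sub_neg_eq_add]
    exact (hhalf (hwxb x t ht) (hwxb _ t ht)).2.trans hc1
  · exact fun x hx t ht =>
      (hhalf (hwtb x (hmem x hx).1 t ht) (hwtb _ (hmem x hx).2 t ht)).1.trans hc2
  · exact fun x hx t ht => (hhalf (hwb x (hmem x hx).1 t ht) (hwb _ (hmem x hx).2 t ht)).2.trans hc3
  · intro x hx t ht
    rw [← sub_eq_add_neg]
    exact (hhalf (hwxb x t ht) (hwxb _ t ht)).1.trans hc1
  · exact fun x hx t ht =>
      (hhalf (hwtb x (hmem x hx).1 t ht) (hwtb _ (hmem x hx).2 t ht)).2.trans hc2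
  · simp only [hwt, hwx, hodd]
    ring
  · simp only [hwt, hwx, hodd]
    ring
  · have e1 : ∀ s, ψ (-x - t + s) s = ψ (x + t - s) s := fun s => by
      rw [← heven]
      congr 1
      ring
    simp only [hwx, e1]
    rw [intervalIntegral.integral_add]
    · ring
    · exact (hψ.comp (by fun_prop : Continuous fun s : ℝ => (x - t + s, s))).intervalIntegrable _ _
    · exact (hψ.comp (by fun_prop : Continuous fun s : ℝ => (x + t - s, s))).intervalIntegrable _ _
  · -- The source has mean value zero, hence a periodic primitive, so that `w` is periodic in `x`.
    have h1 : ∀ s ∈ uIcc 0 t, n (1 - t + s) s = n (-1 - t + s) s := fun s hs => by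
      rw [uIcc_of_le ht] at hs
      have h2 : n (1 - t + s) s - n (-1 - t + s) s = ∫ y in (-1 - t + s)..(1 - t + s), ψ y s :=
        intervalIntegral.integral_interval_sub_left ((hψ1 s).intervalIntegrable _ _)
          ((hψ1 s).intervalIntegrable _ _)
      have h3 : Function.Periodic (fun y => ψ y s) 2 := fun y => hper y s
      have h4 := h3.intervalIntegral_add_eq (-1 - t + s) (-1)
      have e1 : -1 - t + s + 2 = 1 - t + s := by ring
      have e2 : (-1 : ℝ) + 2 = 1 := by norm_num
      rw [e1, e2] at h4
      have h5 : ∫ y in (-1 : ℝ)..1, ψ y s = n 1 s - n (-1) s :=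
        (intervalIntegral.integral_interval_sub_left ((hψ1 s).intervalIntegrable _ _)
          ((hψ1 s).intervalIntegrable _ _)).symm
      have h6 : n 1 s = 0 := h s hs
      rw [h4, h5, hodd, h6] at h2
      linarith
    simp only [hw]
    rw [intervalIntegral.integral_congr h1]
    ring

/-! ### Existence of a `C¹` solution with bounds -/

theorem primitive_zero (e : ℝ → ℝ → ℝ) (t : ℝ) : primitive e 0 t = 0 :=
  intervalIntegral.integral_same

theorem primitive_eq {e : ℝ → ℝ → ℝ} (he : Continuous fun z : ℝ × ℝ => e z.1 z.2) (x t : ℝ) :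
    primitive e x t = (∫ y in (0 : ℝ)..x, e y t) - x * mean e t := by
  have c1 : Continuous fun y => e y t := he.comp (by fun_prop : Continuous fun y : ℝ => (y, t))
  rw [primitive, intervalIntegral.integral_sub (c1.intervalIntegrable _ _)
    (continuous_const.intervalIntegrable _ _)]
  simp

theorem primitive_one {e : ℝ → ℝ → ℝ} (he : Continuous fun z : ℝ × ℝ => e z.1 z.2) (t : ℝ) :
    primitive e 1 t = 0 := by
  rw [primitive_eq he, mean]
  ring

theorem hasDerivAt_primitive {e : ℝ → ℝ → ℝ} (he : Continuous fun z : ℝ × ℝ => e z.1 z.2)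
    (x t : ℝ) : HasDerivAt (fun x => primitive e x t) (e x t - mean e t) x := by
  have c1 : Continuous fun y => e y t := he.comp (by fun_prop : Continuous fun y : ℝ => (y, t))
  have c2 : Continuous fun y => e y t - mean e t := by fun_prop
  exact intervalIntegral.integral_hasDerivAt_right (c2.intervalIntegrable _ _)
    (c2.stronglyMeasurableAtFilter _ _) c2.continuousAt

/-- A solution of the system of class `C¹` up to the boundary, with bounds for it and its first
derivatives. -/
structure IsC1Solution (T K : ℝ) (a g₀ g₁ : ℝ → ℝ) (c : ℝ)
    (p px pt u ux ut : ℝ → ℝ → ℝ) : Prop where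
  pressure : HasBoundedPartials T K p px pt
  flux : HasBoundedPartials T K u ux ut
  mass : ∀ x ∈ Icc (0 : ℝ) 1, ∀ t ∈ Icc 0 T, pt x t + ux x t = 0
  momentum : ∀ x ∈ Icc (0 : ℝ) 1, ∀ t ∈ Icc 0 T, ut x t + px x t + a (u x t) = 0
  left : ∀ t ∈ Icc 0 T, u 0 t = g₀ t
  right : ∀ t ∈ Icc 0 T, u 1 t = g₁ t
  initial_p : ∀ x ∈ Icc (0 : ℝ) 1, p x 0 = c
  initial_u : ∀ x ∈ Icc (0 : ℝ) 1, u x 0 = 0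

/-- The remainder after subtracting a lift: it solves the wave equation with zero boundary values
and the momentum source `F = a (G + v) - (1 - x) b₀ - x b₁`, which vanishes at both ends. Its
space derivative is obtained from the integral equation for `e = ∂ₓv`. -/
theorem IsLift.exists_solution {T K a₁ a₂ : ℝ} (hT : 0 < T) (hK : 0 ≤ K) (ha₁ : 0 ≤ a₁)
    (ha₂ : 0 ≤ a₂) :
    ∃ K' : ℝ, ∀ (a D γ₀ γ₁ : ℝ → ℝ) (c : ℝ) (P Px Pt G Gx Gt : ℝ → ℝ → ℝ),
      IsRegularDamping a₁ a₂ a D → Continuous γ₀ → Continuous γ₁ →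
      (∀ t ∈ Icc 0 T, |a (γ₀ t)| ≤ K) → (∀ t ∈ Icc 0 T, |a (γ₁ t)| ≤ K) →
      IsLift T K c γ₀ γ₁ (fun t => a (γ₀ t)) (fun t => a (γ₁ t)) P Px Pt G Gx Gt →
      ∃ p px pt u ux ut : ℝ → ℝ → ℝ, IsC1Solution T K' a γ₀ γ₁ c p px pt u ux ut := by
  obtain ⟨C, hC, hslope⟩ := exists_slope hT hK ha₁ ha₂
  obtain ⟨B, hB'⟩ : ∃ B, B = a₁ * (K + 2 * C) + K + K := ⟨_, rfl⟩
  have hB : 0 ≤ B := by rw [hB']; positivity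
  refine ⟨K + B * (1 + T) ^ 2, fun a D γ₀ γ₁ c P Px Pt G Gx Gt ha hγ₀ hγ₁ hb₀ hb₁ hL => ?_⟩
  have hc₀ : Continuous fun t => a (γ₀ t) := ha.continuous.comp hγ₀
  have hc₁ : Continuous fun t => a (γ₁ t) := ha.continuous.comp hγ₁
  have hG := hL.flux.continuous
  have hGx := hL.flux.continuous_x
  obtain ⟨e, he, heC, hfix⟩ := hslope a D _ _ G Gx ha hG hGx hc₀ hc₁ hL.flux.bound_x hb₀ hb₁
  set φ : ℝ → ℝ → ℝ := fun x t => D (G x t + primitive e x t) * (Gx x t + (e x t - mean e t))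
    + a (γ₀ t) - a (γ₁ t) with hφ
  have hφc : Continuous fun z : ℝ × ℝ => φ z.1 z.2 := by
    have h1 := continuous_mean he
    have h2 := continuous_primitive he
    have h3 := ha.continuous_deriv
    have h4 := ha.continuous
    simp only [hφ]
    fun_prop
  have hφb : ∀ x ∈ Icc (0 : ℝ) 1, ∀ t ∈ Icc 0 T, |φ x t| ≤ B := fun x hx t ht => by
    have h1 : |Gx x t + (e x t - mean e t)| ≤ K + 2 * C := (abs_add_le _ _).trans
      (add_le_add (hL.flux.bound_x x hx t ht) (abs_sub_mean_le he (fun y _ => heC y t) hx))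
    have h2 := mul_le_mul (ha.abs_deriv_le (G x t + primitive e x t)) h1 (abs_nonneg _) ha₁
    rw [← abs_mul] at h2
    rw [hB']
    exact (abs_sub _ _).trans (add_le_add ((abs_add_le _ _).trans (add_le_add h2 (hb₀ t ht)))
      (hb₁ t ht))
  -- `φ` is the space derivative of the source `F`, which vanishes at the ends.
  set F : ℝ → ℝ → ℝ := fun x t => a (G x t + primitive e x t) - ((1 - x) * a (γ₀ t) + x * a (γ₁ t))
    with hF
  have hFd : ∀ x t, HasDerivAt (fun x => F x t) (φ x t) x := fun x t => by
    have h1 := (ha.hasDerivAt (G x t + primitive e x t)).comp x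
      ((hL.flux.deriv_x x t).add (hasDerivAt_primitive he x t))
    have h2 := (((hasDerivAt_id x).const_sub 1).mul_const (a (γ₀ t))).add
      ((hasDerivAt_id x).mul_const (a (γ₁ t)))
    refine (h1.sub h2).congr_deriv ?_
    simp only [hφ]
    ring
  have hF0 : ∀ t ∈ Icc 0 T, F 0 t = 0 := fun t ht => by
    simp only [hF, primitive_zero, hL.left t ht]
    ring_nf
  have hF1 : ∀ t ∈ Icc 0 T, F 1 t = 0 := fun t ht => by
    simp only [hF, primitive_one he, hL.right t ht]
    ring_nf
  have hint : ∀ x ∈ Icc (0 : ℝ) 1, ∀ t ∈ Icc 0 T, ∫ y in (0 : ℝ)..x, φ (fold y) t = F x t := by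
    intro x hx t ht
    have h1 : ∫ y in (0 : ℝ)..x, φ (fold y) t = ∫ y in (0 : ℝ)..x, φ y t := by
      refine intervalIntegral.integral_congr fun y hy => ?_
      rw [uIcc_of_le hx.1] at hy
      simp only [fold_of_mem ⟨hy.1, hy.2.trans hx.2⟩]
    have h2 := intervalIntegral.integral_eq_sub_of_hasDerivAt (a := 0) (b := x)
      (fun y _ => hFd y t) ((hφc.comp (by fun_prop :
        Continuous fun y : ℝ => (y, t))).intervalIntegrable _ _)
    rw [h1, h2, hF0 t ht, sub_zero]
  obtain ⟨v, vx, vt, q, qx, qt, hv, hq, hmass, hmom, hvx, hv0, hvi, hqi, hv1⟩ :=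
    exists_wave_of_source (ψ := fun y s => φ (fold y) s) hT hB
      (hφc.comp ((continuous_fold.comp continuous_fst).prodMk continuous_snd))
      (fun y s => by simp only [fold_neg]) (fun y s => by simp only [fold_add_two])
      (fun y s hs => hφb _ (fold_mem y) s hs)
  have hvxe : ∀ x ∈ Icc (0 : ℝ) 1, ∀ t ∈ Icc 0 T, vx x t = e x t := fun x hx t ht => by
    rw [hvx, hfix x hx t ht, propagate]
  have hve : ∀ x ∈ Icc (0 : ℝ) 1, ∀ t ∈ Icc 0 T, ∫ y in (0 : ℝ)..x, e y t = v x t := by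
    intro x hx t ht
    have h1 : ∫ y in (0 : ℝ)..x, e y t = ∫ y in (0 : ℝ)..x, vx y t := by
      refine intervalIntegral.integral_congr fun y hy => ?_
      rw [uIcc_of_le hx.1] at hy
      exact (hvxe y ⟨hy.1, hy.2.trans hx.2⟩ t ht).symm
    have h2 := intervalIntegral.integral_eq_sub_of_hasDerivAt (a := 0) (b := x)
      (fun y _ => hv.deriv_x y t) ((hv.continuous_x.comp (by fun_prop :
        Continuous fun y : ℝ => (y, t))).intervalIntegrable _ _)
    rw [h1, h2, hv0, sub_zero]
  have hv1' : ∀ t ∈ Icc 0 T, v 1 t = 0 := fun t ht => hv1 t ht.1 fun s hs => by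
    have hs' : s ∈ Icc 0 T := ⟨hs.1, hs.2.trans ht.2⟩
    rw [hint 1 (by simp) s hs', hF1 s hs']
  have hpv : ∀ x ∈ Icc (0 : ℝ) 1, ∀ t ∈ Icc 0 T, primitive e x t = v x t := fun x hx t ht => by
    have h1 : mean e t = 0 := by
      rw [mean, hve 1 (by simp) t ht, hv1' t ht]
    rw [primitive_eq he, h1, hve x hx t ht]
    ring
  refine ⟨_, _, _, _, _, _, hL.pressure.add hq, hL.flux.add hv, fun x _ t _ => ?_,
    fun x hx t ht => ?_, fun t ht => ?_, fun t ht => ?_, fun x hx => ?_, fun x hx => ?_⟩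
  · linarith [hL.mass x t, hmass x t]
  · have h1 := hL.momentum x t
    have h2 := hmom x t
    rw [hint x hx t ht] at h2
    simp only [hF, hpv x hx t ht] at h2
    linarith
  · simp only [hL.left t ht, hv0, add_zero]
  · simp only [hL.right t ht, hv1' t ht, add_zero]
  · simp only [hL.initial_p x hx, hqi, add_zero]
  · simp only [hL.initial_u x hx, hvi, add_zero]

theorem exists_isC1Solution {a₁ a₂ T : ℝ} (hT : 0 < T) (ha₁ : 0 ≤ a₁) (ha₂ : 0 ≤ a₂) (M : ℝ) :
    ∃ K : ℝ, ∀ (a D g₀ g₁ : ℝ → ℝ) (c : ℝ), IsRegularDamping a₁ a₂ a D →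
      IsBoundaryFlux T M g₀ → IsBoundaryFlux T M g₁ → |c| ≤ M →
      ∃ p px pt u ux ut : ℝ → ℝ → ℝ, IsC1Solution T K a g₀ g₁ c p px pt u ux ut := by
  obtain ⟨K₁, hK₁⟩ := exists_isLift hT a₁ (M * (1 + T)) M
  have hK : 0 ≤ max K₁ 0 + a₁ * |M * (1 + T)| := by positivity
  obtain ⟨K, hK'⟩ := IsLift.exists_solution hT hK ha₁ ha₂
  refine ⟨K, fun a D g₀ g₁ c ha hg₀ hg₁ hc => ?_⟩
  have hM : 0 ≤ M := (abs_nonneg c).trans hc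
  obtain ⟨γ₀, γ₀', h₀, e₀⟩ := hg₀.exists_causal hT hM
  obtain ⟨γ₁, γ₁', h₁, e₁⟩ := hg₁.exists_causal hT hM
  obtain ⟨P, Px, Pt, G, Gx, Gt, hL⟩ := hK₁ a₂ c a D γ₀ γ₀' γ₁ γ₁' ha h₀ h₁ hc
  have hle : K₁ ≤ max K₁ 0 + a₁ * |M * (1 + T)| :=
    (le_max_left _ _).trans (le_add_of_nonneg_right (by positivity))
  have hb : ∀ {γ γ' : ℝ → ℝ}, IsCausal T (M * (1 + T)) γ γ' → ∀ t ∈ Icc 0 T,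
      |a (γ t)| ≤ max K₁ 0 + a₁ * |M * (1 + T)| := fun h t ht =>
    (ha.abs_le _).trans
      ((mul_le_mul_of_nonneg_left ((h.bound t ht.2).trans (le_abs_self _)) ha₁).trans
      (le_add_of_nonneg_left (le_max_right _ _)))
  obtain ⟨p, px, pt, u, ux, ut, h⟩ := hK' a D γ₀ γ₁ c P Px Pt G Gx Gt ha h₀.continuous
    h₁.continuous (hb h₀) (hb h₁)
    { hL with pressure := hL.pressure.mono hle, flux := hL.flux.mono hle }
  exact ⟨p, px, pt, u, ux, ut, { h with
    left := fun t ht => (h.left t ht).trans (e₀ t ht)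
    right := fun t ht => (h.right t ht).trans (e₁ t ht) }⟩

/-! ### Continuous functions as curves in `L²` and `H¹` -/

theorem memLp_IccExtend (f : C(Icc (0 : ℝ) 1, ℝ)) :
    MemLp (IccExtend zero_le_one f) 2 (volume.restrict (Ioo (0 : ℝ) 1)) :=
  MemLp.of_bound (f.continuous.Icc_extend' (h := zero_le_one)).aestronglyMeasurable ‖f‖
    (Eventually.of_forall fun _ => f.norm_coe_le_norm _)

/-- The embedding of the continuous functions on `[0,1]` into `L²(0,1)`. -/
noncomputable def embedL2 : C(Icc (0 : ℝ) 1, ℝ) →L[ℝ] L2 :=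
  LinearMap.mkContinuous
    { toFun := fun f => (memLp_IccExtend f).toLp
      map_add' := fun f g => (MemLp.toLp_add (memLp_IccExtend f) (memLp_IccExtend g)).symm ▸ rfl
      map_smul' := fun c f => (MemLp.toLp_const_smul c (memLp_IccExtend f)).symm ▸ rfl } 1 (by
    intro f
    rw [one_mul]
    have h := Lp.norm_le_of_ae_bound (f := (memLp_IccExtend f).toLp) (norm_nonneg f)
      ((memLp_IccExtend f).coeFn_toLp.mono fun x hx => by
        rw [hx]
        exact f.norm_coe_le_norm _)
    refine h.trans (le_of_eq ?_)
    simp [measureUnivNNReal])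

theorem norm_embedL2_le (f : C(Icc (0 : ℝ) 1, ℝ)) : ‖embedL2 f‖ ≤ ‖f‖ := by
  have h : ‖embedL2‖ ≤ 1 := LinearMap.mkContinuous_norm_le _ zero_le_one _
  exact (embedL2.le_opNorm f).trans (mul_le_of_le_one_left (norm_nonneg f) h)

theorem embedL2_ae (f : C(Icc (0 : ℝ) 1, ℝ)) :
    (embedL2 f : ℝ → ℝ) =ᵐ[volume.restrict (Ioo (0 : ℝ) 1)] IccExtend zero_le_one f :=
  (memLp_IccExtend f).coeFn_toLp

/-- The function `f · t` on the unit interval. -/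
noncomputable def slice (f : ℝ → ℝ → ℝ) (hf : Continuous fun z : ℝ × ℝ => f z.1 z.2) (t : ℝ) :
    C(Icc (0 : ℝ) 1, ℝ) :=
  ⟨fun x => f x t, hf.comp (continuous_subtype_val.prodMk continuous_const)⟩

section Slice

variable {f fx ft : ℝ → ℝ → ℝ} (hf : Continuous fun z : ℝ × ℝ => f z.1 z.2)

theorem embedL2_slice_ae (t : ℝ) :
    ∀ᵐ x ∂volume.restrict (Ioo (0 : ℝ) 1), (embedL2 (slice f hf t) : ℝ → ℝ) x = f x t := by
  filter_upwards [embedL2_ae (slice f hf t), ae_restrict_mem measurableSet_Ioo] with x hx hx'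
  rw [hx, IccExtend_of_mem _ _ (Ioo_subset_Icc_self hx')]
  rfl

theorem continuous_slice : Continuous (slice f hf) :=
  (ContinuousMap.curry (⟨fun z : ℝ × Icc (0 : ℝ) 1 => f z.2 z.1,
    hf.comp ((continuous_subtype_val.comp continuous_snd).prodMk continuous_fst)⟩ :
      C(ℝ × Icc (0 : ℝ) 1, ℝ))).continuous

theorem norm_embedL2_slice_le {K t : ℝ} (hK : 0 ≤ K) (h : ∀ x ∈ Icc (0 : ℝ) 1, |f x t| ≤ K) :
    ‖embedL2 (slice f hf t)‖ ≤ K :=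
  (norm_embedL2_le _).trans ((ContinuousMap.norm_le _ hK).2 fun x => h x x.2)

theorem hasDerivAt_slice (h : HasPartials f fx ft) (t : ℝ) :
    HasDerivAt (slice f h.continuous) (slice ft h.continuous_t t) t := by
  have hc := continuous_slice h.continuous_t
  have e : slice f h.continuous = fun t => slice f h.continuous 0
      + ∫ s in (0 : ℝ)..t, slice ft h.continuous_t s := by
    funext t
    ext x
    have h1 := (ContinuousMap.evalCLM ℝ x : C(Icc (0 : ℝ) 1, ℝ) →L[ℝ] ℝ).intervalIntegral_comp_comm
      (hc.intervalIntegrable (μ := volume) 0 t)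
    have h2 := intervalIntegral.integral_eq_sub_of_hasDerivAt (a := 0) (b := t)
      (fun s _ => h.deriv_t x s) ((h.continuous_t.comp (by fun_prop :
        Continuous fun s : ℝ => ((x : ℝ), s))).intervalIntegrable _ _)
    have h3 : (∫ s in (0 : ℝ)..t, slice ft h.continuous_t s) x = f x t - f x 0 := by
      rw [← h2]
      exact h1.symm
    rw [ContinuousMap.add_apply, h3]
    simp [slice]
  rw [e]
  exact (intervalIntegral.integral_hasDerivAt_right (hc.intervalIntegrable _ _)
    (hc.stronglyMeasurableAtFilter _ _) hc.continuousAt).const_add _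

/-- The element of `H¹(0,1)` given by a continuously differentiable function. -/
noncomputable def h1Slice (h : HasPartials f fx ft) (t : ℝ) : H1 :=
  ⟨WithLp.toLp 2 (embedL2 (slice f h.continuous t), embedL2 (slice fx h.continuous_x t)), by
    refine ⟨(L2.integrableOn _).locallyIntegrableOn, (L2.integrableOn _).locallyIntegrableOn, ?_⟩
    intro φ h1 h2 h3
    have hd : Continuous (deriv φ) := h1.continuous_deriv (by simp)
    have hφ0 : φ 0 = 0 := image_eq_zero_of_notMem_tsupport fun h => by simpa using h3 h
    have hφ1 : φ 1 = 0 := image_eq_zero_of_notMem_tsupport fun h => by simpa using h3 h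
    have hx : Continuous fun x => fx x t :=
      h.continuous_x.comp (by fun_prop : Continuous fun x : ℝ => (x, t))
    have hI := intervalIntegral.integral_mul_deriv_eq_deriv_mul (a := 0) (b := 1)
      (u := fun x => f x t) (v := φ) (fun x _ => h.deriv_x x t)
      (fun x _ => (h1.differentiable (by simp) x).hasDerivAt)
      (hx.intervalIntegrable _ _) (hd.intervalIntegrable _ _)
    rw [hφ0, hφ1, intervalIntegral.integral_of_le zero_le_one,
      intervalIntegral.integral_of_le zero_le_one, integral_Ioc_eq_integral_Ioo,
      integral_Ioc_eq_integral_Ioo] at hI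
    simp only [WithLp.toLp_fst, WithLp.toLp_snd]
    have key : ∀ {g : ℝ → ℝ → ℝ} (hg : Continuous fun z : ℝ × ℝ => g z.1 z.2) (χ : ℝ → ℝ),
        ∫ x in Ioo (0 : ℝ) 1, (embedL2 (slice g hg t) : ℝ → ℝ) x * χ x
          = ∫ x in Ioo (0 : ℝ) 1, g x t * χ x := fun hg χ =>
      integral_congr_ae ((embedL2_slice_ae hg t).mono fun x hx => by
        beta_reduce
        rw [hx])
    rw [key, key, hI]
    ring⟩

theorem h1Slice_toL2 (h : HasPartials f fx ft) (t : ℝ) :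
    (h1Slice h t).toL2 = embedL2 (slice f h.continuous t) := rfl

theorem h1Slice_dx (h : HasPartials f fx ft) (t : ℝ) :
    (h1Slice h t).dx = embedL2 (slice fx h.continuous_x t) := rfl

theorem continuous_h1Slice (h : HasPartials f fx ft) : Continuous (h1Slice h) :=
  ((WithLp.prod_continuous_toLp 2 L2 L2).comp
    ((embedL2.continuous.comp (continuous_slice h.continuous)).prodMk
      (embedL2.continuous.comp (continuous_slice h.continuous_x)))).subtype_mk _

theorem norm_toLp_le {E F : Type*} [NormedAddCommGroup E] [NormedAddCommGroup F] (x : E) (y : F) :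
    ‖WithLp.toLp 2 (x, y)‖ ≤ ‖x‖ + ‖y‖ := by
  rw [WithLp.prod_norm_eq_of_L2]
  refine Real.sqrt_le_iff.2 ⟨by positivity, ?_⟩
  simp only [WithLp.toLp_fst, WithLp.toLp_snd]
  nlinarith [norm_nonneg x, norm_nonneg y]

theorem norm_h1Slice_le {K t : ℝ} (hK : 0 ≤ K) (h : HasPartials f fx ft)
    (h0 : ∀ x ∈ Icc (0 : ℝ) 1, |f x t| ≤ K) (h1 : ∀ x ∈ Icc (0 : ℝ) 1, |fx x t| ≤ K) :
    ‖h1Slice h t‖ ≤ K + K :=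
  (norm_toLp_le _ _).trans (add_le_add (norm_embedL2_slice_le h.continuous hK h0)
    (norm_embedL2_slice_le h.continuous_x hK h1))

theorem H1.rep_eq_of_ae (w : H1) {g : ℝ → ℝ} (hg : ContinuousOn g (Icc 0 1))
    (h : (w.toL2 : ℝ → ℝ) =ᵐ[volume.restrict (Ioo (0 : ℝ) 1)] g) {x : ℝ}
    (hx : x ∈ Icc (0 : ℝ) 1) : w.rep x = g x := by
  refine Measure.eqOn_Icc_of_ae_eq volume zero_ne_one ?_ w.rep_continuousOn hg hx
  rw [← Measure.restrict_congr_set (Ioo_ae_eq_Icc (a := (0 : ℝ)) (b := 1))]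
  exact w.ae_eq_rep.symm.trans h

theorem rep_h1Slice (h : HasPartials f fx ft) (t : ℝ) {x : ℝ} (hx : x ∈ Icc (0 : ℝ) 1) :
    (h1Slice h t).rep x = f x t :=
  (h1Slice h t).rep_eq_of_ae (g := fun x => f x t)
    (h.continuous.comp (by fun_prop : Continuous fun x : ℝ => (x, t))).continuousOn
    (embedL2_slice_ae h.continuous t) hx

end Slice

/-! ### From `C¹` solutions to classical solutions -/

theorem supNorm_le {E : Type*} [NormedAddCommGroup E] {T B : ℝ} {y : ℝ → E}
    (h : ∀ t ∈ Icc 0 T, ‖y t‖ ≤ B) : supNorm T y ≤ ENNReal.ofReal B :=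
  iSup₂_le fun t ht => by
    rw [← ofReal_norm]
    exact ENNReal.ofReal_le_ofReal (h t ht)

namespace IsC1Solution

variable {T K c : ℝ} {a g₀ g₁ : ℝ → ℝ} {p px pt u ux ut : ℝ → ℝ → ℝ}

theorem bound_nonneg (h : IsC1Solution T K a g₀ g₁ c p px pt u ux ut) (hT : 0 ≤ T) : 0 ≤ K :=
  (abs_nonneg _).trans (h.pressure.bound 0 (by simp) 0 ⟨le_rfl, hT⟩)

theorem hasDerivAt_stateL2 (h : IsC1Solution T K a g₀ g₁ c p px pt u ux ut) (t : ℝ) :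
    HasDerivAt (stateL2 (h1Slice h.pressure.toHasPartials) (h1Slice h.flux.toHasPartials))
      (WithLp.toLp 2 (embedL2 (slice pt h.pressure.continuous_t t),
        embedL2 (slice ut h.flux.continuous_t t))) t := by
  have h1 := embedL2.hasFDerivAt.comp_hasDerivAt t (hasDerivAt_slice h.pressure.toHasPartials t)
  have h2 := embedL2.hasFDerivAt.comp_hasDerivAt t (hasDerivAt_slice h.flux.toHasPartials t)
  exact (WithLp.prodContinuousLinearEquiv 2 ℝ L2 L2).symm.hasFDerivAt.comp_hasDerivAt t
    (h1.prodMk h2)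

theorem derivWithin_stateL2 (h : IsC1Solution T K a g₀ g₁ c p px pt u ux ut) (hT : 0 < T) {t : ℝ}
    (ht : t ∈ Icc 0 T) :
    derivWithin (stateL2 (h1Slice h.pressure.toHasPartials) (h1Slice h.flux.toHasPartials))
      (Icc 0 T) t = WithLp.toLp 2 (embedL2 (slice pt h.pressure.continuous_t t),
        embedL2 (slice ut h.flux.continuous_t t)) :=
  (h.hasDerivAt_stateL2 t).hasDerivWithinAt.derivWithin (uniqueDiffOn_Icc hT t ht)

theorem isClassicalSolution (h : IsC1Solution T K a g₀ g₁ c p px pt u ux ut) (hT : 0 < T) :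
    IsClassicalSolution T a g₀ g₁ (fun _ => c) (fun _ => 0)
      (h1Slice h.pressure.toHasPartials) (h1Slice h.flux.toHasPartials) where
  continuousOn := ((WithLp.prod_continuous_toLp 2 H1 H1).comp
    ((continuous_h1Slice _).prodMk (continuous_h1Slice _))).continuousOn
  contDiffOn := by
    refine ContDiff.contDiffOn (contDiff_one_iff_deriv.2
      ⟨fun t => (h.hasDerivAt_stateL2 t).differentiableAt, ?_⟩)
    rw [funext fun t => (h.hasDerivAt_stateL2 t).deriv]
    exact (WithLp.prod_continuous_toLp 2 L2 L2).comp
      ((embedL2.continuous.comp (continuous_slice _)).prodMk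
        (embedL2.continuous.comp (continuous_slice _)))
  mass t ht := by
    rw [h.derivWithin_stateL2 hT (Ioc_subset_Icc_self ht)]
    filter_upwards [embedL2_slice_ae h.pressure.continuous_t t,
      embedL2_slice_ae h.flux.continuous_x t, ae_restrict_mem measurableSet_Ioo] with x h1 h2 hx
    rw [h1Slice_dx, WithLp.toLp_fst, h1, h2]
    exact h.mass x (Ioo_subset_Icc_self hx) t (Ioc_subset_Icc_self ht)
  momentum t ht := by
    rw [h.derivWithin_stateL2 hT (Ioc_subset_Icc_self ht)]
    filter_upwards [embedL2_slice_ae h.flux.continuous_t t,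
      embedL2_slice_ae h.pressure.continuous_x t, embedL2_slice_ae h.flux.continuous t,
      ae_restrict_mem measurableSet_Ioo] with x h1 h2 h3 hx
    rw [h1Slice_dx, h1Slice_toL2, WithLp.toLp_snd, h1, h2, h3]
    exact h.momentum x (Ioo_subset_Icc_self hx) t (Ioc_subset_Icc_self ht)
  boundary_left t ht := by
    rw [rep_h1Slice _ _ (by simp), h.left t (Ioc_subset_Icc_self ht)]
  boundary_right t ht := by
    rw [rep_h1Slice _ _ (by simp), h.right t (Ioc_subset_Icc_self ht)]
  initial_p := by
    filter_upwards [embedL2_slice_ae h.pressure.continuous 0,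
      ae_restrict_mem measurableSet_Ioo] with x h1 hx
    rw [h1Slice_toL2, h1, h.initial_p x (Ioo_subset_Icc_self hx)]
  initial_u := by
    filter_upwards [embedL2_slice_ae h.flux.continuous 0,
      ae_restrict_mem measurableSet_Ioo] with x h1 hx
    rw [h1Slice_toL2, h1, h.initial_u x (Ioo_subset_Icc_self hx)]

theorem supNorm_add_c1Norm_le (h : IsC1Solution T K a g₀ g₁ c p px pt u ux ut) (hT : 0 < T) :
    supNorm T (stateH1 (h1Slice h.pressure.toHasPartials) (h1Slice h.flux.toHasPartials)) +
      c1Norm T (stateL2 (h1Slice h.pressure.toHasPartials) (h1Slice h.flux.toHasPartials))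
      ≤ ENNReal.ofReal (8 * K) := by
  have hK := h.bound_nonneg hT.le
  have e : 8 * K = ((K + K) + (K + K)) + ((K + K) + (K + K)) := by ring
  rw [e, ENNReal.ofReal_add (by positivity) (by positivity), c1Norm]
  refine add_le_add (supNorm_le fun t ht => ?_) ((add_le_add (supNorm_le fun t ht => ?_)
    (supNorm_le fun t ht => ?_)).trans_eq (ENNReal.ofReal_add (p := K + K) (q := K + K)
      (by positivity) (by positivity)).symm)
  · exact (norm_toLp_le _ _).trans (add_le_add
      (norm_h1Slice_le hK _ (fun x hx => h.pressure.bound x hx t ht)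
        fun x hx => h.pressure.bound_x x hx t ht)
      (norm_h1Slice_le hK _ (fun x hx => h.flux.bound x hx t ht)
        fun x hx => h.flux.bound_x x hx t ht))
  · exact (norm_toLp_le _ _).trans (add_le_add
      (norm_embedL2_slice_le _ hK fun x hx => h.pressure.bound x hx t ht)
      (norm_embedL2_slice_le _ hK fun x hx => h.flux.bound x hx t ht))
  · rw [h.derivWithin_stateL2 hT ht]
    exact (norm_toLp_le _ _).trans (add_le_add
      (norm_embedL2_slice_le _ hK fun x hx => h.pressure.bound_t x hx t ht)
      (norm_embedL2_slice_le _ hK fun x hx => h.flux.bound_t x hx t ht))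

theorem pressureDrop_eq (h : IsC1Solution T K a g₀ g₁ c p px pt u ux ut) (t : ℝ) :
    pressureDrop (h1Slice h.pressure.toHasPartials) t = p 0 t - p 1 t := by
  rw [pressureDrop, rep_h1Slice _ _ (by simp), rep_h1Slice _ _ (by simp)]

theorem continuous_pressureDrop (h : IsC1Solution T K a g₀ g₁ c p px pt u ux ut) :
    Continuous (pressureDrop (h1Slice h.pressure.toHasPartials)) := by
  rw [funext h.pressureDrop_eq]
  exact (h.pressure.continuous.comp (by fun_prop : Continuous fun t : ℝ => ((0 : ℝ), t))).sub
    (h.pressure.continuous.comp (by fun_prop : Continuous fun t : ℝ => ((1 : ℝ), t)))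

/-- The pressure drop is even Lipschitz, since the solution is of class `C¹` up to the boundary. -/
theorem holderNorm_pressureDrop_le (h : IsC1Solution T K a g₀ g₁ c p px pt u ux ut) (hT : 0 < T)
    {γ : ℝ} (hγ0 : 0 ≤ γ) (hγ1 : γ ≤ 1) :
    holderNorm T γ (pressureDrop (h1Slice h.pressure.toHasPartials))
      ≤ ENNReal.ofReal (2 * K + 2 * K * (1 + T)) := by
  have hK := h.bound_nonneg hT.le
  rw [ENNReal.ofReal_add (by positivity) (by positivity)]
  refine add_le_add (supNorm_le fun t ht => ?_) (iSup₂_le fun s hs => iSup₂_le fun t ht =>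
    iSup_le fun hst => ENNReal.ofReal_le_ofReal ?_)
  · rw [h.pressureDrop_eq, Real.norm_eq_abs]
    refine (abs_sub _ _).trans ?_
    linarith [h.pressure.bound 0 (by simp) t ht, h.pressure.bound 1 (by simp) t ht]
  · have h1 : |pressureDrop (h1Slice h.pressure.toHasPartials) s
        - pressureDrop (h1Slice h.pressure.toHasPartials) t| ≤ 2 * K * |s - t| := by
      refine (convex_Icc 0 T).norm_image_sub_le_of_norm_hasDerivWithin_le
        (f := pressureDrop (h1Slice h.pressure.toHasPartials))
        (f' := fun t => pt 0 t - pt 1 t) (C := 2 * K) (fun r _ => ?_) (fun r hr => ?_) ht hs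
      · rw [funext h.pressureDrop_eq]
        exact ((h.pressure.deriv_t 0 r).sub (h.pressure.deriv_t 1 r)).hasDerivWithinAt
      · refine (abs_sub _ _).trans ?_
        linarith [h.pressure.bound_t 0 (by simp) r hr, h.pressure.bound_t 1 (by simp) r hr]
    have hpos : 0 < |s - t| := abs_pos.2 (sub_ne_zero.2 hst)
    have hle : |s - t| ≤ 1 + T := by
      rw [abs_le]
      constructor <;> linarith [hs.1, hs.2, ht.1, ht.2]
    -- `|s - t| ≤ |s - t| ^ γ (1 + T) ^ (1 - γ)`
    have h2 : |s - t| ≤ (1 + T) * |s - t| ^ γ := by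
      calc |s - t| = |s - t| ^ (1 - γ) * |s - t| ^ γ := by
            rw [← Real.rpow_add hpos, sub_add_cancel, Real.rpow_one]
        _ ≤ (1 + T) ^ (1 - γ) * |s - t| ^ γ := by
            gcongr
        _ ≤ (1 + T) * |s - t| ^ γ := by
            gcongr
            exact Real.rpow_le_self_of_one_le (by linarith) (by linarith)
    rw [div_le_iff₀ (Real.rpow_pos_of_pos hpos γ)]
    calc _ ≤ 2 * K * |s - t| := h1
      _ ≤ 2 * K * ((1 + T) * |s - t| ^ γ) := by gcongr
      _ = _ := by ring

end IsC1Solution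

/-! ### Uniqueness -/

namespace H1

theorem toL2_sub (f g : H1) : (f - g).toL2 = f.toL2 - g.toL2 := rfl

theorem dx_sub (f g : H1) : (f - g).dx = f.dx - g.dx := rfl

theorem rep_sub (f g : H1) {x : ℝ} (hx : x ∈ Icc (0 : ℝ) 1) :
    (f - g).rep x = f.rep x - g.rep x := by
  refine (f - g).rep_eq_of_ae (g := fun x => f.rep x - g.rep x)
    (f.rep_continuousOn.sub g.rep_continuousOn) ?_ hx
  rw [toL2_sub]
  filter_upwards [Lp.coeFn_sub f.toL2 g.toL2, f.ae_eq_rep, g.ae_eq_rep] with x h1 h2 h3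
  rw [h1, Pi.sub_apply, h2, h3]

theorem eq_of_toL2_eq {f g : H1} (h : f.toL2 = g.toL2) : f = g := by
  have h0 : (f - g).toL2 = 0 := by rw [toL2_sub, h, sub_self]
  have hw : HasWeakDeriv (Ioo 0 1) (f - g).toL2 (f - g).dx := (f - g).2
  have hd : (f - g).dx = 0 := by
    have main := isOpen_Ioo.ae_eq_zero_of_integral_contDiff_smul_eq_zero (μ := volume)
      (f := ((f - g).dx : ℝ → ℝ)) (L2.integrableOn _).locallyIntegrableOn (fun φ h1 h2 h3 => by
        have h4 := hw.integral_eq φ h1 h2 h3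
        have h5 : ∫ x in Ioo (0 : ℝ) 1, ((f - g).toL2 : ℝ → ℝ) x * deriv φ x = 0 := by
          rw [h0]
          refine integral_eq_zero_of_ae ((Lp.coeFn_zero ℝ 2 _).mono fun x hx => ?_)
          beta_reduce
          rw [hx, Pi.zero_apply, zero_mul]
        rw [h5, eq_comm, neg_eq_zero] at h4
        rw [← setIntegral_eq_integral_of_forall_compl_eq_zero (s := Ioo (0 : ℝ) 1)]
        · refine Eq.trans (integral_congr_ae (Eventually.of_forall fun x => ?_)) h4
          simp only [smul_eq_mul, mul_comm]
        · intro x hx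
          rw [image_eq_zero_of_notMem_tsupport fun h' => hx (h3 h'), zero_smul])
    refine Lp.ext ?_
    have h6 := (ae_restrict_iff' (μ := volume) measurableSet_Ioo).2 main
    filter_upwards [h6, Lp.coeFn_zero ℝ 2 (volume.restrict (Ioo (0 : ℝ) 1))] with x h7 h8
    rw [h7, h8, Pi.zero_apply]
  have : (f - g : H1) = 0 := by
    refine Subtype.ext ?_
    refine (WithLp.equiv 2 (L2 × L2)).injective ?_
    exact Prod.ext h0 hd
  exact sub_eq_zero.1 this

/-- An element of `H¹(0,1)` is represented by a primitive of its derivative. -/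
theorem exists_primitive (f : H1) : ∃ F : ℝ → ℝ, AbsolutelyContinuousOnInterval F 0 1 ∧
    (∀ x ∈ Icc (0 : ℝ) 1, f.rep x = F x) ∧
    (∀ᵐ x ∂volume.restrict (Ioo (0 : ℝ) 1), f.toL2 x = F x) ∧
    ∀ᵐ x ∂volume.restrict (Ioo (0 : ℝ) 1), deriv F x = f.dx x := by
  have hw : HasWeakDeriv (Ioo 0 1) f.toL2 f.dx := f.2
  have hv : IntervalIntegrable (f.dx : ℝ → ℝ) volume 0 1 := by
    rw [intervalIntegrable_iff_integrableOn_Ioo_of_le zero_le_one]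
    exact L2.integrableOn _
  obtain ⟨c, hc⟩ := hw.ae_eq_primitive zero_lt_one (L2.integrableOn _) (L2.integrableOn _)
  have hc' := (ae_restrict_iff' (μ := volume) measurableSet_Ioo).2 hc
  have hA0 : AbsolutelyContinuousOnInterval (fun _ : ℝ => c) 0 1 :=
    (contDiff_const (n := 1)).contDiffOn.absolutelyContinuousOnInterval
  have hA : AbsolutelyContinuousOnInterval (fun x => c + ∫ y in (0 : ℝ)..x, f.dx y) 0 1 :=
    hA0.add (hv.absolutelyContinuousOnInterval_intervalIntegral (by simp))
  refine ⟨fun x => c + ∫ y in (0 : ℝ)..x, f.dx y, hA, fun x hx => ?_, hc', ?_⟩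
  · refine f.rep_eq_of_ae (g := fun x => c + ∫ y in (0 : ℝ)..x, f.dx y) ?_ hc' hx
    simpa [uIcc_of_le (zero_le_one (α := ℝ))] using hA.continuousOn
  · rw [ae_restrict_iff' measurableSet_Ioo]
    filter_upwards [hv.ae_hasDerivAt_integral] with x hx hx'
    have h1 : x ∈ uIcc (0 : ℝ) 1 := by
      rw [uIcc_of_le zero_le_one]
      exact Ioo_subset_Icc_self hx'
    exact ((hx h1 0 (by simp)).const_add c).deriv

/-- Integration by parts. -/
theorem integral_mul_dx (f g : H1) : ∫ x in Ioo (0 : ℝ) 1, f.toL2 x * g.dx x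
    = f.rep 1 * g.rep 1 - f.rep 0 * g.rep 0 - ∫ x in Ioo (0 : ℝ) 1, g.toL2 x * f.dx x := by
  obtain ⟨F, hF, hFr, hFe, hFd⟩ := f.exists_primitive
  obtain ⟨G, hG, hGr, hGe, hGd⟩ := g.exists_primitive
  have hI := hF.integral_mul_deriv_eq_deriv_mul hG
  rw [intervalIntegral.integral_of_le zero_le_one,
    intervalIntegral.integral_of_le zero_le_one, integral_Ioc_eq_integral_Ioo,
    integral_Ioc_eq_integral_Ioo] at hI
  rw [hFr 0 (by simp), hFr 1 (by simp), hGr 0 (by simp), hGr 1 (by simp)]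
  have e1 : ∫ x in Ioo (0 : ℝ) 1, f.toL2 x * g.dx x = ∫ x in Ioo (0 : ℝ) 1, F x * deriv G x := by
    refine integral_congr_ae ?_
    filter_upwards [hFe, hGd] with x h1 h2
    rw [h1, h2]
  have e2 : ∫ x in Ioo (0 : ℝ) 1, g.toL2 x * f.dx x = ∫ x in Ioo (0 : ℝ) 1, deriv F x * G x := by
    refine integral_congr_ae ?_
    filter_upwards [hGe, hFd] with x h1 h2
    rw [h1, h2, mul_comm]
  rw [e1, e2, hI]

end H1

theorem L2.inner_eq (f g : L2) : inner ℝ f g = ∫ x in Ioo (0 : ℝ) 1, f x * g x := by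
  rw [MeasureTheory.L2.inner_def]
  refine integral_congr_ae (Eventually.of_forall fun x => ?_)
  simp [mul_comm]

theorem L2.integrable_mul (f g : L2) :
    Integrable (fun x => f x * g x) (volume.restrict (Ioo (0 : ℝ) 1)) :=
  (Lp.memLp f).integrable_mul (Lp.memLp g)

/-- The energy of the difference of two solutions does not increase: the wave part contributes
only boundary terms, which vanish, and the damping is monotone. -/
theorem IsClassicalSolution.inner_deriv_nonpos {T : ℝ} {a g₀ g₁ p₀ u₀ : ℝ → ℝ}
    (ha : Monotone a) {p u q v : ℝ → H1} (h : IsClassicalSolution T a g₀ g₁ p₀ u₀ p u)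
    (h' : IsClassicalSolution T a g₀ g₁ p₀ u₀ q v) {t : ℝ} (ht : t ∈ Ioc 0 T) :
    inner ℝ (stateL2 p u t - stateL2 q v t)
      (derivWithin (stateL2 p u) (Icc 0 T) t - derivWithin (stateL2 q v) (Icc 0 T) t) ≤ 0 := by
  set y := derivWithin (stateL2 p u) (Icc 0 T) t
  set z := derivWithin (stateL2 q v) (Icc 0 T) t
  rw [WithLp.prod_inner_apply]
  change inner ℝ (p t - q t).toL2 (y.fst - z.fst) + inner ℝ (u t - v t).toL2 (y.snd - z.snd) ≤ 0
  rw [L2.inner_eq, L2.inner_eq]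
  have e1 : ∫ x in Ioo (0 : ℝ) 1, (p t - q t).toL2 x * (y.fst - z.fst : L2) x
      = -∫ x in Ioo (0 : ℝ) 1, (p t - q t).toL2 x * (u t - v t).dx x := by
    rw [← integral_neg]
    refine integral_congr_ae ?_
    rw [H1.dx_sub]
    filter_upwards [h.mass t ht, h'.mass t ht, Lp.coeFn_sub y.fst z.fst,
      Lp.coeFn_sub (u t).dx (v t).dx] with x h1 h2 h3 h4
    rw [h3, h4, Pi.sub_apply, Pi.sub_apply]
    linear_combination ((p t - q t).toL2 x) * (h1 - h2)
  have e2 : ∫ x in Ioo (0 : ℝ) 1, (u t - v t).toL2 x * (y.snd - z.snd : L2) x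
      ≤ ∫ x in Ioo (0 : ℝ) 1, -((u t - v t).toL2 x * (p t - q t).dx x) := by
    refine integral_mono_ae (L2.integrable_mul _ _) (L2.integrable_mul _ _).neg ?_
    rw [H1.dx_sub, H1.toL2_sub]
    filter_upwards [h.momentum t ht, h'.momentum t ht, Lp.coeFn_sub y.snd z.snd,
      Lp.coeFn_sub (p t).dx (q t).dx, Lp.coeFn_sub (u t).toL2 (v t).toL2] with x h1 h2 h3 h4 h5
    rw [h3, h4, h5, Pi.sub_apply, Pi.sub_apply, Pi.sub_apply]
    have hm : 0 ≤ ((u t).toL2 x - (v t).toL2 x) * (a ((u t).toL2 x) - a ((v t).toL2 x)) := by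
      rcases le_total ((u t).toL2 x) ((v t).toL2 x) with h6 | h6
      · exact mul_nonneg_of_nonpos_of_nonpos (sub_nonpos.2 h6) (sub_nonpos.2 (ha h6))
      · exact mul_nonneg (sub_nonneg.2 h6) (sub_nonneg.2 (ha h6))
    have e3 : y.snd x - z.snd x
        = -((p t).dx x - (q t).dx x) - (a ((u t).toL2 x) - a ((v t).toL2 x)) := by linarith
    rw [e3]
    linarith
  have b0 : (u t - v t).rep 0 = 0 := by
    rw [H1.rep_sub _ _ (by simp), h.boundary_left t ht, h'.boundary_left t ht, sub_self]
  have b1 : (u t - v t).rep 1 = 0 := by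
    rw [H1.rep_sub _ _ (by simp), h.boundary_right t ht, h'.boundary_right t ht, sub_self]
  rw [integral_neg, H1.integral_mul_dx, b0, b1] at e2
  rw [e1]
  linarith

theorem IsClassicalSolution.eqOn {T : ℝ} (hT : 0 < T) {a g₀ g₁ p₀ u₀ : ℝ → ℝ}
    (ha : Monotone a) {p u q v : ℝ → H1} (h : IsClassicalSolution T a g₀ g₁ p₀ u₀ p u)
    (h' : IsClassicalSolution T a g₀ g₁ p₀ u₀ q v) :
    EqOn p q (Icc 0 T) ∧ EqOn u v (Icc 0 T) := by
  have hd : ∀ t ∈ Icc 0 T, HasDerivWithinAt (fun t => stateL2 p u t - stateL2 q v t)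
      (derivWithin (stateL2 p u) (Icc 0 T) t - derivWithin (stateL2 q v) (Icc 0 T) t)
      (Icc 0 T) t := fun t ht =>
    ((h.contDiffOn.differentiableOn one_ne_zero t ht).hasDerivWithinAt).sub
      ((h'.contDiffOn.differentiableOn one_ne_zero t ht).hasDerivWithinAt)
  have hanti : AntitoneOn (fun t => ‖stateL2 p u t - stateL2 q v t‖ ^ 2) (Icc 0 T) := by
    refine antitoneOn_of_hasDerivWithinAt_nonpos (convex_Icc 0 T)
      (fun t ht => ((hd t ht).continuousWithinAt.norm.pow 2))
      (fun t ht => ((hd t (interior_subset ht)).norm_sq).mono interior_subset) fun t ht => ?_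
    rw [interior_Icc] at ht
    have := h.inner_deriv_nonpos ha h' (Ioo_subset_Ioc_self ht)
    linarith
  have h0 : stateL2 p u 0 - stateL2 q v 0 = 0 := by
    have hp : (p 0).toL2 = (q 0).toL2 := Lp.ext (by
      filter_upwards [h.initial_p, h'.initial_p] with x h1 h2
      rw [h1, h2])
    have hu : (u 0).toL2 = (v 0).toL2 := Lp.ext (by
      filter_upwards [h.initial_u, h'.initial_u] with x h1 h2
      rw [h1, h2])
    rw [stateL2, stateL2, hp, hu, sub_self]
  have hz : ∀ t ∈ Icc 0 T, stateL2 p u t = stateL2 q v t := fun t ht => by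
    have h1 := hanti ⟨le_rfl, hT.le⟩ ht ht.1
    simp only [h0, norm_zero] at h1
    have h2 : ‖stateL2 p u t - stateL2 q v t‖ = 0 := by
      have := norm_nonneg (stateL2 p u t - stateL2 q v t)
      nlinarith
    exact sub_eq_zero.1 (norm_eq_zero.1 h2)
  refine ⟨fun t ht => H1.eq_of_toL2_eq ?_, fun t ht => H1.eq_of_toL2_eq ?_⟩
  · have : (stateL2 p u t).fst = (stateL2 q v t).fst := by rw [hz t ht]
    exact this
  · have : (stateL2 p u t).snd = (stateL2 q v t).snd := by rw [hz t ht]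
    exact this

end PipeFlow

theorem mainTheorem1 (a₀ a₁ a₂ a₃ T M : ℝ)
    (ha₀ : 0 < a₀) (ha₁ : 0 < a₁) (ha₂ : 0 < a₂) (ha₃ : 0 < a₃) (hT : 0 < T) :
    ∃ (C : ℝ≥0) (C' : ℝ → ℝ≥0), ∀ (a g₀ g₁ : ℝ → ℝ) (c : ℝ),
      PipeFlow.IsDampingLaw a₀ a₁ a₂ a₃ a →
      PipeFlow.IsBoundaryFlux T M g₀ → PipeFlow.IsBoundaryFlux T M g₁ → |c| ≤ M →
      ∃ p u : ℝ → PipeFlow.H1,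
        PipeFlow.IsClassicalSolution T a g₀ g₁ (fun _ => c) (fun _ => 0) p u ∧
        (∀ q v : ℝ → PipeFlow.H1,
          PipeFlow.IsClassicalSolution T a g₀ g₁ (fun _ => c) (fun _ => 0) q v →
          EqOn q p (Icc 0 T) ∧ EqOn v u (Icc 0 T)) ∧
        PipeFlow.supNorm T (PipeFlow.stateH1 p u) + PipeFlow.c1Norm T (PipeFlow.stateL2 p u)
          ≤ (C : ℝ≥0∞) ∧
        ContinuousOn (PipeFlow.pressureDrop p) (Icc 0 T) ∧
        ∀ γ : ℝ, 0 ≤ γ → γ < 1 / 2 →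
          PipeFlow.holderNorm T γ (PipeFlow.pressureDrop p) ≤ (C' γ : ℝ≥0∞) := by
  obtain ⟨K, hK⟩ := PipeFlow.exists_isC1Solution hT ha₁.le ha₂.le M
  refine ⟨(8 * K).toNNReal, fun _ => (2 * K + 2 * K * (1 + T)).toNNReal,
    fun a g₀ g₁ c ha hg₀ hg₁ hc => ?_⟩
  obtain ⟨D, hD⟩ := ha.exists_isRegularDamping ha₀
  obtain ⟨p, px, pt, u, ux, ut, h⟩ := hK a D g₀ g₁ c hD hg₀ hg₁ hc
  have hs := h.isClassicalSolution hT
  exact ⟨_, _, hs, fun q v hqv => hqv.eqOn hT hD.monotone hs, h.supNorm_add_c1Norm_le hT,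
    h.continuous_pressureDrop.continuousOn, fun γ h0 h1 =>
      h.holderNorm_pressureDrop_le hT h0 (by linarith)⟩
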